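/- **Setting.** For every $n\ge 1$ let $p=p_n$ be a dimension, $A_1,\dots,A_n\in\mathbb R^{p\times p}$ deterministic symmetric matrices, $x^*\in\mathbb R^p$ a signal and $b_i=\langle x^*,A_ix^*\rangle+\varepsilon_i$, $i=1,\dots,n$, the observations (all these objects may vary with $n$). Put $\varphi_i(x)=\langle x,A_ix\rangle-b_i$ and $$f(x)=\frac1{4n}\sum_{i=1}^n\varphi_i(x)^2,\qquad H(x)=\frac2n\sum_{i=1}^nA_ix\,x^{\top}A_i .$$ Norms are Euclidean for vectors and spectral for matrices. **The method (GRNM).** Fix $\epsilon_1>0$, $\beta>0$, $\mu_1,\mu_2,\alpha_1,\alpha_2,\delta\in(0,1)$ and start from an arbitrary $x^0\in\mathbb R^p$ (possibly depending on $n$ and on the noise). Write $g^k=\nabla f(x^k)$. Phase I: as long as $\|g^k\|\ge\epsilon_1$, set $x^{k+1}=x^k-\alpha_1^{j}g^k$ with the smallest integer $j\ge0$ such that $f(x^k-\alpha_1^{j}g^k)\le f(x^k)-\mu_1\alpha_1^{j}\|g^k\|^2$. Phase II: from the first $k$ with $\|g^k\|<\epsilon_1$ on, set $d^k=-\big(H(x^k)+\beta\|g^k\|^{\delta}I\big)^{-1}g^k$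 and $x^{k+1}=x^k+\alpha_2^{j}d^k$ with the smallest integer $j\ge0$ such that $f(x^k+\alpha_2^{j}d^k)\le f(x^k)+\mu_2\alpha_2^{j}\langle g^k,d^k\rangle$. If $g^k=0$ the method stops, and the sequence is continued by $x^{k+1}=x^k$. **Theorem.** Let $\underline\lambda,\bar\lambda,\varsigma,r>0$ and the parameters of the method be fixed, independently of $n$, with $\bar\lambda<3\underline\lambda$ and $\mu_2\in(0,1/2)$. Assume: 1. for all sufficiently large $n$, $\ \underline\lambda\|u\|^2\|v\|^2\le\frac1n\sum_{i=1}^n\langle u,A_iv\rangle^2\le\bar\lambda\|u\|^2\|v\|^2\ $ for all $u,v\in\mathbb R^p$; 2. for every $n$ the errors $\varepsilon_1,\dots,\varepsilon_n$ are i.i.d. with mean zero and positive variance, and sub-Gaussian with proxy $\varsigma^2$, i.e. $\mathbb E e^{s\varepsilon_i}\le e^{\varsigma^2s^2/2}$ for all $s\in\mathbb R$; 3. $\|x^*\|\ge r$ for all sufficiently large $n$; 4. $p^3\log(1+2n)/n\to0$ as $n\to\infty$. Call $\bar x$ *admissible* if it is a nonzero accumulation point of the GRNM sequence $\{x^k\}$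 and $$\Big\|\frac1n\sum_{i=1}^n\varphi_i(\bar x)A_i\Big\|<2\underline\lambda\|\bar x\|^2 .\qquad\text{(suff-cod)}$$ Then the GRNM sequence converges to any admissible $\bar x$, superlinearly in probability as $n\to\infty$. Precisely: for all sufficiently large $n$ and every realization of the noise, if $\bar x$ is admissible then the whole sequence $\{x^k\}$ converges to $\bar x$; and for every $\eta>0$, $$\mathbb P\Big(\text{there is an admissible }\bar x\text{ with }\limsup_{k\to\infty}\frac{\|x^{k+1}-\bar x\|}{\|x^k-\bar x\|}\ge\eta\Big)\longrightarrow0\qquad(n\to\infty),$$ where $0/0:=0$ and $\mathbb P$ denotes outer probability if the event is not measurable. -/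

import Mathlib

open MeasureTheory ProbabilityTheory Filter Topology
open scoped ENNReal NNReal

noncomputable section

namespace QMR

/-- The signal space: `ℝᵖ` with the Euclidean norm. -/
abbrev Vec (p : ℕ) : Type := EuclideanSpace ℝ (Fin p)

/-- The product `M v` of a square matrix and a vector. -/
def act {p : ℕ} (M : Matrix (Fin p) (Fin p) ℝ) (v : Vec p) : Vec p :=
  Matrix.toEuclideanCLM (𝕜 := ℝ) M v

/-- The spectral norm of a square matrix. -/
def specNorm {p : ℕ} (M : Matrix (Fin p) (Fin p) ℝ) : ℝ :=
  ‖Matrix.toEuclideanCLM (𝕜 := ℝ) M‖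

/-- The isometry-type condition
`lam ‖u‖² ‖v‖² ≤ (1/n) ∑ᵢ ⟨u, Aᵢ v⟩² ≤ Lam ‖u‖² ‖v‖²` for all `u, v`. -/
def IsometryBounds {n p : ℕ} (A : Fin n → Matrix (Fin p) (Fin p) ℝ) (lam Lam : ℝ) : Prop :=
  ∀ u v : Vec p,
    lam * ‖u‖ ^ 2 * ‖v‖ ^ 2 ≤ (1 / (n : ℝ)) * ∑ i, (inner ℝ u (act (A i) v)) ^ 2 ∧
    (1 / (n : ℝ)) * ∑ i, (inner ℝ u (act (A i) v)) ^ 2 ≤ Lam * ‖u‖ ^ 2 * ‖v‖ ^ 2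

/-- The noise `ε₁, …, εₙ` is i.i.d. and sub-Gaussian with proxy `ς²`, that is
`𝔼 exp (s εᵢ) ≤ exp (ς² s² / 2)` for all real `s`, with mean zero and positive variance. -/
structure IsSubgaussianNoise {Ω : Type*} [MeasurableSpace Ω] (P : Measure Ω) {n : ℕ}
    (ε : Fin n → Ω → ℝ) (ς : ℝ≥0) : Prop where
  indep : iIndepFun ε P
  identDistrib : ∀ i j, IdentDistrib (ε i) (ε j) P P
  subgaussian : ∀ i, HasSubgaussianMGF (ε i) (ς ^ 2) P
  mean_zero : ∀ i, ∫ ω, ε i ω ∂P = 0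
  variance_pos : ∀ i, 0 < variance (ε i) P

/-- The observations `bᵢ = ⟨x*, Aᵢ x*⟩ + εᵢ`. -/
def observe {n p : ℕ} (A : Fin n → Matrix (Fin p) (Fin p) ℝ) (xstar : Vec p)
    (e : Fin n → ℝ) : Fin n → ℝ :=
  fun i => inner ℝ xstar (act (A i) xstar) + e i

/-- The residuals `φᵢ(x) = ⟨x, Aᵢ x⟩ - bᵢ`. -/
def residual {n p : ℕ} (A : Fin n → Matrix (Fin p) (Fin p) ℝ) (b : Fin n → ℝ)
    (i : Fin n) (x : Vec p) : ℝ :=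
  inner ℝ x (act (A i) x) - b i

/-- The least squares objective `f(x) = (1/(4n)) ∑ᵢ (⟨x, Aᵢ x⟩ - bᵢ)²`. -/
def objective {n p : ℕ} (A : Fin n → Matrix (Fin p) (Fin p) ℝ) (b : Fin n → ℝ)
    (x : Vec p) : ℝ :=
  (1 / (4 * (n : ℝ))) * ∑ i, residual A b i x ^ 2

/-- The gradient `∇f(x)` of the objective. -/
def grad {n p : ℕ} (A : Fin n → Matrix (Fin p) (Fin p) ℝ) (b : Fin n → ℝ)
    (x : Vec p) : Vec p :=
  gradient (objective A b) x

/-- The `n × p` matrix `𝐀(x)` whose `i`-th row is `Aᵢ x`. -/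
def rowMatrix {n p : ℕ} (A : Fin n → Matrix (Fin p) (Fin p) ℝ) (x : Vec p) :
    Matrix (Fin n) (Fin p) ℝ :=
  Matrix.of fun i j => act (A i) x j

/-- The matrix `H(x) = (2/n) 𝐀(x)ᵀ 𝐀(x)`. -/
def gaussNewton {n p : ℕ} (A : Fin n → Matrix (Fin p) (Fin p) ℝ) (x : Vec p) :
    Matrix (Fin p) (Fin p) ℝ :=
  (2 / (n : ℝ)) • ((rowMatrix A x).transpose * rowMatrix A x)

/-- The matrix `(1/n) ∑ᵢ φᵢ(x) Aᵢ`. -/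
def residualMatrix {n p : ℕ} (A : Fin n → Matrix (Fin p) (Fin p) ℝ) (b : Fin n → ℝ)
    (x : Vec p) : Matrix (Fin p) (Fin p) ℝ :=
  (1 / (n : ℝ)) • ∑ i, residual A b i x • A i

/-- The parameters of the gradient regularized Newton method. -/
structure Params where
  ε₁ : ℝ
  β : ℝ
  μ₁ : ℝ
  μ₂ : ℝ
  α₁ : ℝ
  α₂ : ℝ
  δ : ℝ
  ε₁_pos : 0 < ε₁
  β_pos : 0 < β
  μ₁_mem : μ₁ ∈ Set.Ioo (0 : ℝ) 1
  μ₂_mem : μ₂ ∈ Set.Ioo (0 : ℝ) 1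
  α₁_mem : α₁ ∈ Set.Ioo (0 : ℝ) 1
  α₂_mem : α₂ ∈ Set.Ioo (0 : ℝ) 1
  δ_mem : δ ∈ Set.Ioo (0 : ℝ) 1

/-- A gradient descent step `x - α₁ʲ ∇f(x)`, where `j` is the smallest nonnegative integer with
`f(x - α₁ʲ ∇f(x)) ≤ f(x) - μ₁ α₁ʲ ‖∇f(x)‖²`.
(Such a `j` always exists, since `f` is smooth; so the infimum is a minimum.) -/
def gradStep {n p : ℕ} (A : Fin n → Matrix (Fin p) (Fin p) ℝ) (b : Fin n → ℝ)
    (c : Params) (x : Vec p) : Vec p :=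
  let g := grad A b x
  let j := sInf {j : ℕ | objective A b (x - c.α₁ ^ j • g) ≤
    objective A b x - c.μ₁ * c.α₁ ^ j * ‖g‖ ^ 2}
  x - c.α₁ ^ j • g

/-- The regularized Newton direction `d = -(H(x) + β ‖∇f(x)‖^δ I)⁻¹ ∇f(x)`. -/
def newtonDir {n p : ℕ} (A : Fin n → Matrix (Fin p) (Fin p) ℝ) (b : Fin n → ℝ)
    (c : Params) (x : Vec p) : Vec p :=
  -act ((gaussNewton A x + (c.β * ‖grad A b x‖ ^ c.δ) • (1 : Matrix (Fin p) (Fin p) ℝ))⁻¹)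
    (grad A b x)

/-- A regularized Newton step `x + α₂ʲ d`, where `j` is the smallest nonnegative integer with
`f(x + α₂ʲ d) ≤ f(x) + μ₂ α₂ʲ ⟨∇f(x), d⟩`.
(Such a `j` always exists: `d` is a descent direction if `∇f(x) ≠ 0`, and `d = 0` otherwise.
In the latter case the step does not move, so a run that stops at a stationary point is
continued by a constant sequence.) -/
def newtonStep {n p : ℕ} (A : Fin n → Matrix (Fin p) (Fin p) ℝ) (b : Fin n → ℝ)
    (c : Params) (x : Vec p) : Vec p :=
  let d := newtonDir A b c x
  let j := sInf {j : ℕ | objective A b (x + c.α₂ ^ j • d) ≤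
    objective A b x + c.μ₂ * c.α₂ ^ j * inner ℝ (grad A b x) d}
  x + c.α₂ ^ j • d

open Classical in
/-- The state after `k` iterations: the iterate `xᵏ`, and whether phase I is still running at `xᵏ`,
that is, whether `‖∇f(xʲ)‖ ≥ ε₁` for all `j ≤ k`. While phase I is running the next iterate is
computed by a gradient step; once it has ended all further steps are Newton steps. -/
def grnmState {n p : ℕ} (A : Fin n → Matrix (Fin p) (Fin p) ℝ) (b : Fin n → ℝ)
    (c : Params) (x₀ : Vec p) : ℕ → Vec p × Prop
  | 0 => (x₀, c.ε₁ ≤ ‖grad A b x₀‖)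
  | k + 1 =>
    let s := grnmState A b c x₀ k
    let y := if s.2 then gradStep A b c s.1 else newtonStep A b c s.1
    (y, s.2 ∧ c.ε₁ ≤ ‖grad A b y‖)

/-- The sequence `x⁰, x¹, x², …` generated by the gradient regularized Newton method. -/
def grnm {n p : ℕ} (A : Fin n → Matrix (Fin p) (Fin p) ℝ) (b : Fin n → ℝ)
    (c : Params) (x₀ : Vec p) (k : ℕ) : Vec p :=
  (grnmState A b c x₀ k).1

/-- `xbar` is a nonzero accumulation point of the sequence generated by the method, and it satisfies
`‖(1/n) ∑ᵢ φᵢ(xbar) Aᵢ‖ < 2 lam ‖xbar‖²`. -/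
def IsGoodAccPt {n p : ℕ} (A : Fin n → Matrix (Fin p) (Fin p) ℝ) (b : Fin n → ℝ)
    (c : Params) (x₀ : Vec p) (lam : ℝ) (xbar : Vec p) : Prop :=
  xbar ≠ 0 ∧ MapClusterPt xbar atTop (grnm A b c x₀) ∧
    specNorm (residualMatrix A b xbar) < 2 * lam * ‖xbar‖ ^ 2

/-- The asymptotic linear rate `limsup_k ‖xᵏ⁺¹ - xbar‖ / ‖xᵏ - xbar‖ ∈ [0, ∞]`,
where `0 / 0 = 0` and `c / 0 = ∞` for `c > 0`. -/
def rate {p : ℕ} (x : ℕ → Vec p) (xbar : Vec p) : ℝ≥0∞ :=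
  limsup (fun k => ‖x (k + 1) - xbar‖ₑ / ‖x k - xbar‖ₑ) atTop

end QMR

end

/-!
The objective is `f(x) = ‖Φ x x - b‖² / 4` for the symmetric bilinear map `Φ u v = n^{-1/2} (⟨u,
Aᵢ v⟩)ᵢ`, and the isometry condition says that `‖Φ u v‖` is comparable to `‖u‖ ‖v‖`
(`isComparable_designForm`). With the residual `ρ = Φ x x - b`, the Hessian at `x` is the sum of
the Gauss-Newton form `2 ⟨Φ x u, Φ x v⟩ ≥ 2 lam ‖x‖² ‖u‖²` (for `u = v`) and the residual form
`⟨ρ, Φ u v⟩`. The exact Taylor expansion of the quartic `f` (`lsq_add`) gives every estimate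
below.

*Convergence.* A backtracking step from `x` decreases `f` by at least `ψ(x) ‖∇f(x)‖²`, where `ψ`
is continuous and positive, for Newton steps away from `x = 0`. Hence nonzero accumulation points
are stationary (`lsqGrad_eq_zero_of_decrease`), and the first phase must have ended, because its
gradients stay away from `0`. At an admissible point the residual form is smaller than `2 lam
‖xbar‖²`, so the Hessian is positive definite and `f` grows quadratically there. Since the Newton
steps near a stationary point are short, the iterates are captured
(`tendsto_of_quadratic_growth`).

*Rate.* Let `S` bound the residual form at `xbar`. If `S / (2 lam ‖xbar‖²) < 1 - 2 μ₂`, full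
Newton steps are eventually accepted, and such steps contract the error by any factor larger than
`S / (2 lam ‖xbar‖²)` (`IsComparable.eventually_contraction`). It remains to see that this ratio
tends to `0` in probability. A stationary point with `S ≤ 2 lam ‖xbar‖²` satisfies `lam ‖xbar -
x*‖ ‖xbar + x*‖ ≤ 2 τ`, where `τ` bounds the noise form `(1/n) ∑ εᵢ ⟨u, Aᵢ v⟩`
(`IsComparable.error_le_of_stationary`); therefore `S = O(τ)`, while `‖xbar‖` stays away from `0`.
Finally, the squared Frobenius norm of `(1/n) ∑ εᵢ Aᵢ` has expectation of order `p² / n`, because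
each entry of it is a weighted sum of independent errors, so `τ → 0` in probability by Markov's
inequality (`measure_noiseMatrix_le`).
-/

namespace QMR

open scoped RealInnerProductSpace

/-! ### Least squares for a bilinear map -/

section Bilinear

variable {E F : Type*} [NormedAddCommGroup E] [InnerProductSpace ℝ E]
  [NormedAddCommGroup F] [InnerProductSpace ℝ F]

/-- A symmetric bilinear map `Φ` whose values are comparable to the products of the norms:
`l ‖u‖ ‖v‖ ≤ ‖Φ u v‖ ≤ L ‖u‖ ‖v‖`. -/
structure IsComparable (Φ : E →L[ℝ] E →L[ℝ] F) (l L : ℝ) : Prop where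
  l_pos : 0 < l
  L_pos : 0 < L
  symm : ∀ u v, Φ u v = Φ v u
  lower : ∀ u v, l * ‖u‖ * ‖v‖ ≤ ‖Φ u v‖
  upper : ∀ u v, ‖Φ u v‖ ≤ L * ‖u‖ * ‖v‖

/-- The quartic least squares objective `x ↦ ‖Φ x x - b‖² / 4`. -/
noncomputable def lsq (Φ : E →L[ℝ] E →L[ℝ] F) (b : F) (x : E) : ℝ := ‖Φ x x - b‖ ^ 2 / 4

/-- The gradient of `lsq Φ b` for symmetric `Φ`. -/
noncomputable def lsqGrad [CompleteSpace E] [CompleteSpace F] (Φ : E →L[ℝ] E →L[ℝ] F) (b : F)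
    (x : E) : E :=
  ContinuousLinearMap.adjoint (Φ x) (Φ x x - b)

variable {Φ : E →L[ℝ] E →L[ℝ] F} {b : F} {l L : ℝ}

lemma IsComparable.abs_inner_le (h : IsComparable Φ l L) (u v w y : E) :
    |⟪Φ u v, Φ w y⟫| ≤ L ^ 2 * ‖u‖ * ‖v‖ * ‖w‖ * ‖y‖ := by
  calc |⟪Φ u v, Φ w y⟫| ≤ ‖Φ u v‖ * ‖Φ w y‖ := abs_real_inner_le_norm _ _
    _ ≤ (L * ‖u‖ * ‖v‖) * (L * ‖w‖ * ‖y‖) := by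
        have := h.L_pos
        exact mul_le_mul (h.upper _ _) (h.upper _ _) (norm_nonneg _) (by positivity)
    _ = _ := by ring

lemma IsComparable.norm_sq_le (h : IsComparable Φ l L) (u v : E) :
    ‖Φ u v‖ ^ 2 ≤ L ^ 2 * ‖u‖ ^ 2 * ‖v‖ ^ 2 := by
  calc ‖Φ u v‖ ^ 2 ≤ (L * ‖u‖ * ‖v‖) ^ 2 := by gcongr; exact h.upper u v
    _ = _ := by ring

lemma IsComparable.le_norm_sq (h : IsComparable Φ l L) (u v : E) :
    l ^ 2 * ‖u‖ ^ 2 * ‖v‖ ^ 2 ≤ ‖Φ u v‖ ^ 2 := by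
  have := h.l_pos
  calc l ^ 2 * ‖u‖ ^ 2 * ‖v‖ ^ 2 = (l * ‖u‖ * ‖v‖) ^ 2 := by ring
    _ ≤ _ := by gcongr; exact h.lower u v

lemma continuous_lsq : Continuous (lsq Φ b) := by
  unfold lsq; fun_prop

lemma lsq_nonneg (x : E) : 0 ≤ lsq Φ b x := by unfold lsq; positivity

/-- The exact Taylor expansion of the quartic polynomial `lsq Φ b`. -/
lemma lsq_add (hs : ∀ u v, Φ u v = Φ v u) (x h : E) :
    lsq Φ b (x + h) = lsq Φ b x + ⟪Φ x x - b, Φ x h⟫ + ‖Φ x h‖ ^ 2 + ⟪Φ x x - b, Φ h h⟫ / 2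
      + ⟪Φ x h, Φ h h⟫ + ‖Φ h h‖ ^ 2 / 4 := by
  have e : Φ (x + h) (x + h) - b = (Φ x x - b) + ((2 : ℝ) • Φ x h + Φ h h) := by
    simp only [map_add, add_apply, hs h x]
    module
  unfold lsq
  rw [e, norm_add_sq_real, norm_add_sq_real, inner_add_right, inner_smul_right, inner_smul_left,
    norm_smul]
  simp
  ring

/-- A bound for the quadratic and higher terms of `lsq Φ b` at `x`, for increments of norm at most
`D`. -/
noncomputable def curvatureBound (Φ : E →L[ℝ] E →L[ℝ] F) (b : F) (L : ℝ) (x : E) (D : ℝ) : ℝ :=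
  L ^ 2 * ‖x‖ ^ 2 + L * ‖Φ x x - b‖ / 2 + L ^ 2 * ‖x‖ * D + L ^ 2 * D ^ 2 / 4 + 1

lemma IsComparable.curvatureBound_pos (h : IsComparable Φ l L) (x : E) {D : ℝ} (hD : 0 ≤ D) :
    0 < curvatureBound Φ b L x D := by
  have := h.L_pos
  unfold curvatureBound; positivity

/-- Applied to the residual vector, this bounds the residual form by a multiple of the square root
of the objective. -/
lemma IsComparable.abs_inner_residual_le (h : IsComparable Φ l L) (y : F) (u v : E) :
    |⟪y, Φ u v⟫| ≤ L * ‖y‖ * ‖u‖ * ‖v‖ := by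
  calc |⟪y, Φ u v⟫| ≤ ‖y‖ * ‖Φ u v‖ := abs_real_inner_le_norm _ _
    _ ≤ ‖y‖ * (L * ‖u‖ * ‖v‖) := by gcongr; exact h.upper u v
    _ = _ := by ring

lemma IsComparable.lsq_add_smul_le (h : IsComparable Φ l L) (x d : E) {t D : ℝ} (ht : 0 ≤ t)
    (ht1 : t ≤ 1) (hd : ‖d‖ ≤ D) :
    lsq Φ b (x + t • d) ≤ lsq Φ b x + t * ⟪Φ x x - b, Φ x d⟫
      + t ^ 2 * (curvatureBound Φ b L x D * ‖d‖ ^ 2) := by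
  have hL := h.L_pos
  rw [lsq_add h.symm]
  have h1 := h.norm_sq_le x (t • d)
  have h2 := le_of_abs_le (h.abs_inner_residual_le (Φ x x - b) (t • d) (t • d))
  have h3 := le_of_abs_le (h.abs_inner_le x (t • d) (t • d) (t • d))
  have h4 := h.norm_sq_le (t • d) (t • d)
  have e : ⟪Φ x x - b, Φ x (t • d)⟫ = t * ⟪Φ x x - b, Φ x d⟫ := by
    rw [map_smul, inner_smul_right]
  rw [e]
  rw [norm_smul, Real.norm_eq_abs, abs_of_nonneg ht] at h1 h2 h3 h4
  have a3 : t ^ 3 * (L ^ 2 * ‖x‖ * ‖d‖ ^ 3) ≤ t ^ 2 * (L ^ 2 * ‖x‖ * (D * ‖d‖ ^ 2)) := by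
    apply mul_le_mul (pow_le_pow_of_le_one ht ht1 (by norm_num)) _ (by positivity) (by positivity)
    rw [show ‖d‖ ^ 3 = ‖d‖ * ‖d‖ ^ 2 by ring]
    gcongr
  have a4 : t ^ 4 * (L ^ 2 * ‖d‖ ^ 4) ≤ t ^ 2 * (L ^ 2 * (D ^ 2 * ‖d‖ ^ 2)) := by
    apply mul_le_mul (pow_le_pow_of_le_one ht ht1 (by norm_num)) _ (by positivity) (by positivity)
    rw [show ‖d‖ ^ 4 = ‖d‖ ^ 2 * ‖d‖ ^ 2 by ring]
    gcongr
  have a5 : 0 ≤ t ^ 2 * ‖d‖ ^ 2 := by positivity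
  unfold curvatureBound
  nlinarith [h1, h2, h3, h4, a3, a4, a5]

section Gradient

variable [CompleteSpace E] [CompleteSpace F]

lemma inner_lsqGrad (x h : E) : ⟪lsqGrad Φ b x, h⟫ = ⟪Φ x x - b, Φ x h⟫ := by
  rw [lsqGrad, ContinuousLinearMap.adjoint_inner_left]

lemma continuous_lsqGrad : Continuous (lsqGrad Φ b) := by
  unfold lsqGrad
  exact (((ContinuousLinearMap.adjoint (𝕜 := ℝ) (E := E) (F := F)).continuous.comp
    Φ.continuous).clm_apply (by fun_prop))

lemma IsComparable.hasGradientAt_lsq (h : IsComparable Φ l L) (x : E) :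
    HasGradientAt (lsq Φ b) (lsqGrad Φ b x) x := by
  rw [hasGradientAt_iff_hasFDerivAt]
  have h1 : HasFDerivAt (fun x => Φ x x - b) _ x :=
    (Φ.hasFDerivAt.clm_apply (hasFDerivAt_id x)).sub_const b
  have h2 := h1.norm_sq.mul_const (1 / 4 : ℝ)
  have e : lsq Φ b = fun x => ‖Φ x x - b‖ ^ 2 * (1 / 4) := by
    funext y; unfold lsq; ring
  rw [e]
  refine h2.congr_fderiv ?_
  ext w
  simp [inner_lsqGrad, h.symm w x, inner_sub_left]
  ring

end Gradient

/-! ### Backtracking line search -/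

/-- **Backtracking.** If `ψ t ≤ ψ₀ + t s + t² C q` on `[0, 1]` with slope `s ≤ -m q`, the smallest
exponent `j` passing the Armijo test exists, and the step `αʲ` is bounded below. -/
lemma armijo_spec {ψ : ℝ → ℝ} {ψ₀ s m C q α μ : ℝ} (hα : α ∈ Set.Ioo (0 : ℝ) 1) (hμ : μ < 1)
    (hm : 0 < m) (hC : 0 < C) (hq : 0 ≤ q) (hs : s ≤ -(m * q))
    (hψ : ∀ t, 0 ≤ t → t ≤ 1 → ψ t ≤ ψ₀ + t * s + t ^ 2 * (C * q)) :
    ψ (α ^ sInf {j : ℕ | ψ (α ^ j) ≤ ψ₀ + μ * α ^ j * s}) ≤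
        ψ₀ + μ * α ^ sInf {j : ℕ | ψ (α ^ j) ≤ ψ₀ + μ * α ^ j * s} * s ∧
      min 1 (α * (1 - μ) * m / C) ≤ α ^ sInf {j : ℕ | ψ (α ^ j) ≤ ψ₀ + μ * α ^ j * s} := by
  obtain ⟨hα0, hα1⟩ := hα
  have key : ∀ j : ℕ, α ^ j * C ≤ (1 - μ) * m → ψ (α ^ j) ≤ ψ₀ + μ * α ^ j * s := by
    intro j hj
    have ht : 0 < α ^ j := by positivity
    have h1 := hψ (α ^ j) ht.le (pow_le_one₀ hα0.le hα1.le)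
    have h2 : α ^ j * (α ^ j * C * q) ≤ α ^ j * ((1 - μ) * m * q) := by gcongr
    have h3 : α ^ j * ((1 - μ) * (m * q)) ≤ α ^ j * ((1 - μ) * (-s)) := by
      have : 0 < 1 - μ := by linarith
      gcongr; linarith
    nlinarith
  have hne : {j : ℕ | ψ (α ^ j) ≤ ψ₀ + μ * α ^ j * s}.Nonempty := by
    obtain ⟨j, hj⟩ := exists_pow_lt_of_lt_one
      (div_pos (mul_pos (show 0 < 1 - μ by linarith) hm) hC) hα1
    exact ⟨j, key j ((lt_div_iff₀ hC).1 hj).le⟩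
  refine ⟨Nat.sInf_mem hne, ?_⟩
  generalize hj : sInf {j : ℕ | ψ (α ^ j) ≤ ψ₀ + μ * α ^ j * s} = j
  rcases j with _ | j
  · simp
  · refine (min_le_right _ _).trans ?_
    -- the preceding exponent fails the test, so its step was too long for `key`
    have : j ∉ {j : ℕ | ψ (α ^ j) ≤ ψ₀ + μ * α ^ j * s} :=
      Nat.notMem_of_lt_sInf (by omega)
    have h1 : (1 - μ) * m < α ^ j * C := by
      by_contra hc
      exact this (key j (not_lt.1 hc))
    rw [div_le_iff₀ hC, pow_succ]
    nlinarith

/-- The step length `αʲ` found by backtracking from `x` along `d`. -/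
noncomputable def armijoStep (f : E → ℝ) (α μ : ℝ) (x d : E) (s : ℝ) : ℝ :=
  α ^ sInf {j : ℕ | f (x + α ^ j • d) ≤ f x + μ * α ^ j * s}

/-- A step of the backtracking line search along a direction `d` with
`⟨∇f(x), d⟩ ≤ -m ‖d‖²` decreases the objective by a multiple of `‖d‖²`. -/
lemma IsComparable.armijo_decrease (h : IsComparable Φ l L) {x d : E} {m D α μ s : ℝ}
    (hα : α ∈ Set.Ioo (0 : ℝ) 1) (hμ : μ ∈ Set.Ioo (0 : ℝ) 1) (hm : 0 < m) (hd : ‖d‖ ≤ D)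
    (hs : ⟪Φ x x - b, Φ x d⟫ = s) (hsm : s ≤ -(m * ‖d‖ ^ 2)) :
    lsq Φ b (x + armijoStep (lsq Φ b) α μ x d s • d) ≤ lsq Φ b x -
        μ * min 1 (α * (1 - μ) * m / curvatureBound Φ b L x D) * m * ‖d‖ ^ 2 ∧
      ‖armijoStep (lsq Φ b) α μ x d s • d‖ ≤ ‖d‖ := by
  have hD : 0 ≤ D := (norm_nonneg d).trans hd
  obtain ⟨h1, h2⟩ := armijo_spec (ψ := fun t => lsq Φ b (x + t • d)) (ψ₀ := lsq Φ b x) (s := s)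
    (q := ‖d‖ ^ 2) hα hμ.2 hm (h.curvatureBound_pos (b := b) x hD) (by positivity) hsm
    (fun t ht ht1 => by rw [← hs]; exact h.lsq_add_smul_le x d ht ht1 hd)
  change lsq Φ b (x + armijoStep (lsq Φ b) α μ x d s • d) ≤
    lsq Φ b x + μ * armijoStep (lsq Φ b) α μ x d s * s at h1
  change _ ≤ armijoStep (lsq Φ b) α μ x d s at h2
  have hp : 0 < armijoStep (lsq Φ b) α μ x d s := pow_pos hα.1 _
  have hp1 : armijoStep (lsq Φ b) α μ x d s ≤ 1 := pow_le_one₀ hα.1.le hα.2.le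
  constructor
  · have := hμ.1
    have e1 : μ * armijoStep (lsq Φ b) α μ x d s * s ≤
        μ * armijoStep (lsq Φ b) α μ x d s * -(m * ‖d‖ ^ 2) := by gcongr
    have e2 : μ * min 1 (α * (1 - μ) * m / curvatureBound Φ b L x D) * (m * ‖d‖ ^ 2) ≤
        μ * armijoStep (lsq Φ b) α μ x d s * (m * ‖d‖ ^ 2) := by gcongr
    linarith
  · rw [norm_smul, Real.norm_eq_abs, abs_of_pos hp]
    exact mul_le_of_le_one_left (norm_nonneg _) hp1

end Bilinear

/-! ### A capture principle -/

/-- Capture: a sequence that decreases `f` cannot leave the neighbourhood of a strict local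
minimizer of quadratic growth, once its steps near the minimizer are short. -/
lemma tendsto_of_quadratic_growth {X : Type*} [NormedAddCommGroup X] {f : X → ℝ}
    (hf : Continuous f) {x : ℕ → X} {xbar : X}
    (hacc : MapClusterPt xbar atTop x) (hmono : Antitone fun k => f (x k)) {κ ρ : ℝ}
    (hκ : 0 < κ) (hρ : 0 < ρ) (hgrow : ∀ z, ‖z - xbar‖ ≤ ρ → κ * ‖z - xbar‖ ^ 2 ≤ f z - f xbar)
    {D : X → ℝ} (hD : Tendsto D (𝓝 xbar) (𝓝 0))
    (hstep : ∀ᶠ z in 𝓝 xbar, ∀ k, x k = z → ‖x (k + 1) - z‖ ≤ D z) :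
    Tendsto x atTop (𝓝 xbar) := by
  rw [Metric.tendsto_nhds]
  intro ε hε
  have hev : ∀ᶠ z in 𝓝 xbar, (∀ k, x k = z → ‖x (k + 1) - z‖ ≤ D z) ∧ D z < ρ / 2 :=
    hstep.and (hD.eventually (gt_mem_nhds (by positivity)))
  obtain ⟨r₁, hr₁, hball⟩ := Metric.eventually_nhds_iff.1 hev
  set r := min (min ε r₁) (ρ / 2) with hr
  have hr0 : 0 < r := by positivity
  have hclose : ∀ᶠ z in 𝓝 xbar, dist z xbar < r ∧ f z < f xbar + κ * r ^ 2 :=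
    (show ∀ᶠ z in 𝓝 xbar, dist z xbar < r from Metric.ball_mem_nhds xbar hr0).and
      (hf.continuousAt.eventually (gt_mem_nhds (by have : 0 < κ * r ^ 2 := by positivity
                                                   linarith)))
  obtain ⟨K, hK⟩ := (hacc.frequently hclose).exists
  have htrap : ∀ k, K ≤ k → dist (x k) xbar < r := by
    intro k hk
    induction k, hk using Nat.le_induction with
    | base => exact hK.1
    | succ k hk ih =>
      have hb := hball (ih.trans_le ((min_le_left _ _).trans (min_le_right _ _)))
      have h1 := hb.1 k rfl
      have h2 : dist (x k) xbar < ρ / 2 := ih.trans_le (min_le_right _ _)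
      rw [dist_eq_norm] at h2
      have h3 : ‖x (k + 1) - xbar‖ ≤ ρ := by
        calc ‖x (k + 1) - xbar‖ = ‖(x (k + 1) - x k) + (x k - xbar)‖ := by congr 1; abel
          _ ≤ ‖x (k + 1) - x k‖ + ‖x k - xbar‖ := norm_add_le _ _
          _ ≤ ρ := by linarith [hb.2]
      have h4 := hgrow _ h3
      have h5 : f (x (k + 1)) ≤ f (x K) := hmono (by omega)
      have h6 : κ * ‖x (k + 1) - xbar‖ ^ 2 < κ * r ^ 2 := by linarith [hK.2]
      rw [dist_eq_norm]
      exact lt_of_pow_lt_pow_left₀ 2 hr0.le (lt_of_mul_lt_mul_left h6 hκ.le)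
  filter_upwards [eventually_ge_atTop K] with k hk
  exact (htrap k hk).trans_le ((min_le_left _ _).trans (min_le_left _ _))

section Bilinear

variable {E F : Type*} [NormedAddCommGroup E] [InnerProductSpace ℝ E]
  [NormedAddCommGroup F] [InnerProductSpace ℝ F]
  {Φ : E →L[ℝ] E →L[ℝ] F} {b : F} {l L : ℝ}

/-! ### Descent steps -/

lemma continuousAt_curvatureBound {D : E → ℝ} {x : E} (hD : ContinuousAt D x) :
    ContinuousAt (fun y => curvatureBound Φ b L y (D y)) x := by
  unfold curvatureBound; fun_prop

section Steps

variable [CompleteSpace E] [CompleteSpace F]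

/-- `y` is obtained from `x` by a gradient step with backtracking. -/
def IsGradStep (Φ : E →L[ℝ] E →L[ℝ] F) (b : F) (α μ : ℝ) (x y : E) : Prop :=
  y = x + armijoStep (lsq Φ b) α μ x (-lsqGrad Φ b x) ⟪lsqGrad Φ b x, -lsqGrad Φ b x⟫ •
    (-lsqGrad Φ b x)

/-- `d` solves the regularized Gauss-Newton equation `(H(x) + σ I) d = -∇f(x)`, in weak form, where
`⟨d, H(x) w⟩ = 2 ⟨Φ x d, Φ x w⟩`. -/
def IsNewtonDir (Φ : E →L[ℝ] E →L[ℝ] F) (b : F) (σ : ℝ) (x d : E) : Prop :=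
  ∀ w, 2 * ⟪Φ x d, Φ x w⟫ + σ * ⟪d, w⟫ = -⟪lsqGrad Φ b x, w⟫

/-- `y` is obtained from `x` by a regularized Newton step with backtracking. At `x = 0`, where the
Newton equation can be singular, the direction is required to vanish. -/
def IsNewtonStep (Φ : E →L[ℝ] E →L[ℝ] F) (b : F) (β δ α μ : ℝ) (x y : E) : Prop :=
  ∃ d, IsNewtonDir Φ b (β * ‖lsqGrad Φ b x‖ ^ δ) x d ∧ (x = 0 → d = 0) ∧
    y = x + armijoStep (lsq Φ b) α μ x d ⟪lsqGrad Φ b x, d⟫ • d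

/-- Lower bound for the decrease of the objective in a gradient step, relative to `‖∇f(x)‖²`. -/
noncomputable def gradDecrease (Φ : E →L[ℝ] E →L[ℝ] F) (b : F) (L α μ : ℝ) (x : E) : ℝ :=
  μ * min 1 (α * (1 - μ) / curvatureBound Φ b L x ‖lsqGrad Φ b x‖)

/-- Upper bound for the length of the Newton direction. -/
noncomputable def newtonLength (Φ : E →L[ℝ] E →L[ℝ] F) (b : F) (l : ℝ) (x : E) : ℝ :=
  ‖lsqGrad Φ b x‖ / (2 * l ^ 2 * ‖x‖ ^ 2)

/-- Lower bound for the decrease of the objective in a Newton step, relative to `‖∇f(x)‖²`. -/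
noncomputable def newtonDecrease (Φ : E →L[ℝ] E →L[ℝ] F) (b : F) (l L β δ α μ : ℝ) (x : E) : ℝ :=
  μ * min 1 (α * (1 - μ) * (2 * l ^ 2 * ‖x‖ ^ 2) /
    curvatureBound Φ b L x (newtonLength Φ b l x)) * (2 * l ^ 2 * ‖x‖ ^ 2) /
    (2 * L ^ 2 * ‖x‖ ^ 2 + β * ‖lsqGrad Φ b x‖ ^ δ) ^ 2

lemma IsComparable.gradStep_decrease (h : IsComparable Φ l L) {α μ : ℝ} {x y : E}
    (hα : α ∈ Set.Ioo (0 : ℝ) 1) (hμ : μ ∈ Set.Ioo (0 : ℝ) 1) (hy : IsGradStep Φ b α μ x y) :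
    lsq Φ b y ≤ lsq Φ b x - gradDecrease Φ b L α μ x * ‖lsqGrad Φ b x‖ ^ 2 := by
  have := (h.armijo_decrease (b := b) (x := x) (d := -lsqGrad Φ b x) (m := 1)
    (D := ‖lsqGrad Φ b x‖) hα hμ one_pos (by simp) (inner_lsqGrad x _).symm (by simp)).1
  rw [← hy, norm_neg, mul_one, mul_one] at this
  exact this

lemma IsNewtonDir.inner_grad {σ : ℝ} {x d : E} (hd : IsNewtonDir Φ b σ x d) :
    ⟪lsqGrad Φ b x, d⟫ = -(2 * ‖Φ x d‖ ^ 2 + σ * ‖d‖ ^ 2) := by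
  have := hd d
  simp only [real_inner_self_eq_norm_sq] at this
  linarith

lemma IsNewtonDir.inner_grad_le (h : IsComparable Φ l L) {σ : ℝ} (hσ : 0 ≤ σ) {x d : E}
    (hd : IsNewtonDir Φ b σ x d) :
    ⟪lsqGrad Φ b x, d⟫ ≤ -(2 * l ^ 2 * ‖x‖ ^ 2 * ‖d‖ ^ 2) := by
  rw [hd.inner_grad]
  have := h.le_norm_sq x d
  have : 0 ≤ σ * ‖d‖ ^ 2 := by positivity
  linarith

lemma IsNewtonDir.norm_le (h : IsComparable Φ l L) {σ : ℝ} (hσ : 0 ≤ σ) {x d : E} (hx : x ≠ 0)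
    (hd : IsNewtonDir Φ b σ x d) : ‖d‖ ≤ newtonLength Φ b l x := by
  have hl := h.l_pos
  have hx' : 0 < ‖x‖ := norm_pos_iff.2 hx
  rw [newtonLength, le_div_iff₀ (by positivity)]
  rcases (norm_nonneg d).eq_or_lt with h0 | h0
  · rw [← h0]; simp
  have h1 := hd.inner_grad_le h hσ
  have h2 := neg_le_of_abs_le (abs_real_inner_le_norm (lsqGrad Φ b x) d)
  refine le_of_mul_le_mul_right ?_ h0
  linarith

lemma IsNewtonDir.norm_grad_le (h : IsComparable Φ l L) {σ : ℝ} (hσ : 0 ≤ σ) {x d : E}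
    (hd : IsNewtonDir Φ b σ x d) :
    ‖lsqGrad Φ b x‖ ≤ (2 * L ^ 2 * ‖x‖ ^ 2 + σ) * ‖d‖ := by
  rcases (norm_nonneg (lsqGrad Φ b x)).eq_or_lt with h0 | h0
  · rw [← h0]; positivity
  have h1 := hd (lsqGrad Φ b x)
  rw [real_inner_self_eq_norm_sq] at h1
  have h2 := neg_le_of_abs_le (h.abs_inner_le x d x (lsqGrad Φ b x))
  have h3 := mul_le_mul_of_nonneg_left
    (neg_le_of_abs_le (abs_real_inner_le_norm d (lsqGrad Φ b x))) hσ
  refine le_of_mul_le_mul_right ?_ h0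
  nlinarith

lemma IsComparable.newtonStep_decrease (h : IsComparable Φ l L) {β δ α μ : ℝ} {x y : E}
    (hβ : 0 < β) (hα : α ∈ Set.Ioo (0 : ℝ) 1) (hμ : μ ∈ Set.Ioo (0 : ℝ) 1) (hx : x ≠ 0)
    (hy : IsNewtonStep Φ b β δ α μ x y) :
    lsq Φ b y ≤ lsq Φ b x - newtonDecrease Φ b l L β δ α μ x * ‖lsqGrad Φ b x‖ ^ 2 ∧
      ‖y - x‖ ≤ newtonLength Φ b l x := by
  obtain ⟨d, hd, -, rfl⟩ := hy
  have hl := h.l_pos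
  have hL := h.L_pos
  have hx' : 0 < ‖x‖ := norm_pos_iff.2 hx
  have hσ : 0 ≤ β * ‖lsqGrad Φ b x‖ ^ δ := by positivity
  have hdn := hd.norm_le h hσ hx
  have h1 := h.armijo_decrease (b := b) (x := x) (d := d) (m := 2 * l ^ 2 * ‖x‖ ^ 2) hα hμ
    (by positivity) hdn (inner_lsqGrad x _).symm (hd.inner_grad_le h hσ)
  constructor
  · refine h1.1.trans (sub_le_sub_left ?_ _)
    have hc := h.curvatureBound_pos (b := b) x ((norm_nonneg d).trans hdn)
    have hμ0 := hμ.1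
    have hα0 := hα.1
    have hμ1 : 0 < 1 - μ := by linarith [hμ.2]
    have h2 : ‖lsqGrad Φ b x‖ ^ 2 ≤
        (2 * L ^ 2 * ‖x‖ ^ 2 + β * ‖lsqGrad Φ b x‖ ^ δ) ^ 2 * ‖d‖ ^ 2 := by
      rw [← mul_pow]; gcongr; exact hd.norm_grad_le h hσ
    have h3 : 0 < (2 * L ^ 2 * ‖x‖ ^ 2 + β * ‖lsqGrad Φ b x‖ ^ δ) ^ 2 := by positivity
    rw [newtonDecrease, div_mul_eq_mul_div, mul_div_assoc]
    have h4 : 0 ≤ min 1 (α * (1 - μ) * (2 * l ^ 2 * ‖x‖ ^ 2) /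
        curvatureBound Φ b L x (newtonLength Φ b l x)) := le_min zero_le_one (by positivity)
    gcongr
    rw [div_le_iff₀ h3]
    linarith
  · rw [add_sub_cancel_left]
    exact h1.2.trans hdn

lemma IsComparable.gradDecrease_pos (h : IsComparable Φ l L) {α μ : ℝ}
    (hα : α ∈ Set.Ioo (0 : ℝ) 1) (hμ : μ ∈ Set.Ioo (0 : ℝ) 1) (x : E) :
    0 < gradDecrease Φ b L α μ x := by
  have hc := h.curvatureBound_pos (b := b) x (norm_nonneg (lsqGrad Φ b x))
  have hμ0 := hμ.1
  have hα0 := hα.1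
  have hμ1 : 0 < 1 - μ := by linarith [hμ.2]
  have h4 : 0 < min 1 (α * (1 - μ) / curvatureBound Φ b L x ‖lsqGrad Φ b x‖) :=
    lt_min zero_lt_one (by positivity)
  unfold gradDecrease; positivity

lemma newtonLength_nonneg (x : E) : 0 ≤ newtonLength Φ b l x := by
  unfold newtonLength; positivity

lemma IsComparable.newtonDecrease_pos (h : IsComparable Φ l L) {β δ α μ : ℝ} (hβ : 0 < β)
    (hα : α ∈ Set.Ioo (0 : ℝ) 1) (hμ : μ ∈ Set.Ioo (0 : ℝ) 1) {x : E} (hx : x ≠ 0) :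
    0 < newtonDecrease Φ b l L β δ α μ x := by
  have hl := h.l_pos
  have hL := h.L_pos
  have hx' : 0 < ‖x‖ := norm_pos_iff.2 hx
  have hc := h.curvatureBound_pos (b := b) x (newtonLength_nonneg (Φ := Φ) (b := b) (l := l) x)
  have hμ0 := hμ.1
  have hα0 := hα.1
  have hμ1 : 0 < 1 - μ := by linarith [hμ.2]
  have h4 : 0 < min 1 (α * (1 - μ) * (2 * l ^ 2 * ‖x‖ ^ 2) /
    curvatureBound Φ b L x (newtonLength Φ b l x)) := lt_min zero_lt_one (by positivity)
  unfold newtonDecrease; positivity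

lemma IsComparable.continuousAt_gradDecrease (h : IsComparable Φ l L) {α μ : ℝ} (x : E) :
    ContinuousAt (gradDecrease Φ b L α μ) x := by
  have hg : ContinuousAt (lsqGrad Φ b) x := continuous_lsqGrad.continuousAt
  have hc := (h.curvatureBound_pos (b := b) x (norm_nonneg (lsqGrad Φ b x))).ne'
  have := continuousAt_curvatureBound (Φ := Φ) (b := b) (L := L) hg.norm
  unfold gradDecrease
  fun_prop (disch := assumption)

lemma IsComparable.continuousAt_newtonLength (h : IsComparable Φ l L) {x : E} (hx : x ≠ 0) :
    ContinuousAt (newtonLength Φ b l) x := by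
  have hl := h.l_pos
  have hx' : 0 < ‖x‖ := norm_pos_iff.2 hx
  have hg : ContinuousAt (lsqGrad Φ b) x := continuous_lsqGrad.continuousAt
  have : 2 * l ^ 2 * ‖x‖ ^ 2 ≠ 0 := by positivity
  unfold newtonLength
  fun_prop (disch := assumption)

lemma continuousAt_norm_lsqGrad_rpow {δ : ℝ} (hδ : 0 ≤ δ) (x : E) :
    ContinuousAt (fun y => ‖lsqGrad Φ b y‖ ^ δ) x :=
  ((continuous_lsqGrad.norm).rpow_const fun _ => Or.inr hδ).continuousAt

lemma IsComparable.continuousAt_newtonDecrease (h : IsComparable Φ l L) {β δ α μ : ℝ} (hβ : 0 < β)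
    (hδ : 0 ≤ δ) {x : E} (hx : x ≠ 0) :
    ContinuousAt (newtonDecrease Φ b l L β δ α μ) x := by
  have hl := h.l_pos
  have hL := h.L_pos
  have hx' : 0 < ‖x‖ := norm_pos_iff.2 hx
  have hg := continuousAt_norm_lsqGrad_rpow (Φ := Φ) (b := b) hδ x
  have hc := (h.curvatureBound_pos (b := b) x
    (newtonLength_nonneg (Φ := Φ) (b := b) (l := l) x)).ne'
  have := continuousAt_curvatureBound (Φ := Φ) (b := b) (L := L)
    (h.continuousAt_newtonLength (b := b) hx)
  have h2 : (2 * L ^ 2 * ‖x‖ ^ 2 + β * ‖lsqGrad Φ b x‖ ^ δ) ^ 2 ≠ 0 := by positivity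
  unfold newtonDecrease
  fun_prop (disch := assumption)

/-- The gradient vanishes at `0`, which is the only point where the Newton equation is singular. -/
lemma lsqGrad_zero : lsqGrad Φ b 0 = 0 := by
  refine ext_inner_right ℝ fun w => ?_
  rw [inner_lsqGrad]; simp

lemma IsComparable.newtonStep_le (h : IsComparable Φ l L) {β δ α μ : ℝ} {x y : E}
    (hβ : 0 < β) (hα : α ∈ Set.Ioo (0 : ℝ) 1) (hμ : μ ∈ Set.Ioo (0 : ℝ) 1)
    (hy : IsNewtonStep Φ b β δ α μ x y) : lsq Φ b y ≤ lsq Φ b x := by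
  by_cases hx : x = 0
  · obtain ⟨d, -, hd, rfl⟩ := hy
    simp [hd hx]
  · have h1 := (h.newtonStep_decrease hβ hα hμ hx hy).1
    have h2 := h.newtonDecrease_pos (b := b) (δ := δ) hβ hα hμ hx
    have : 0 ≤ newtonDecrease Φ b l L β δ α μ x * ‖lsqGrad Φ b x‖ ^ 2 := by positivity
    linarith

/-! ### Stationarity and quadratic growth -/

/-- Accumulation points of a sequence with sufficient decrease are stationary. -/
lemma lsqGrad_eq_zero_of_decrease {x : ℕ → E} {xbar : E} (hacc : MapClusterPt xbar atTop x)
    (hmono : Antitone fun k => lsq Φ b (x k)) {ψ : E → ℝ} (hψ : ContinuousAt ψ xbar)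
    (hpos : 0 < ψ xbar)
    (hdec : ∀ᶠ z in 𝓝 xbar, ∀ k, x k = z →
      lsq Φ b (x (k + 1)) ≤ lsq Φ b z - ψ z * ‖lsqGrad Φ b z‖ ^ 2) :
    lsqGrad Φ b xbar = 0 := by
  obtain ⟨φ, hφ, hlim⟩ := hacc.tendsto_subseq
  have hconv : ∃ c, Tendsto (fun k => lsq Φ b (x k)) atTop (𝓝 c) :=
    ⟨_, tendsto_atTop_ciInf hmono ⟨0, by rintro _ ⟨k, rfl⟩; exact lsq_nonneg _⟩⟩
  obtain ⟨c, hc⟩ := hconv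
  have h0 : Tendsto (fun k => lsq Φ b (x (φ k)) - lsq Φ b (x (φ k + 1))) atTop (𝓝 (c - c)) :=
    (hc.comp hφ.tendsto_atTop).sub ((hc.comp (tendsto_add_atTop_nat 1)).comp hφ.tendsto_atTop)
  have h1 : Tendsto (fun k => ψ (x (φ k)) * ‖lsqGrad Φ b (x (φ k))‖ ^ 2) atTop
      (𝓝 (ψ xbar * ‖lsqGrad Φ b xbar‖ ^ 2)) :=
    (hψ.mul (continuous_lsqGrad.norm.pow 2).continuousAt).tendsto.comp hlim
  have h2 : ∀ᶠ k in atTop, ψ (x (φ k)) * ‖lsqGrad Φ b (x (φ k))‖ ^ 2 ≤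
      lsq Φ b (x (φ k)) - lsq Φ b (x (φ k + 1)) := by
    filter_upwards [hlim.eventually hdec] with k hk
    have := hk (φ k) rfl
    simp only [Function.comp_apply] at this
    linarith
  have h3 := le_of_tendsto_of_tendsto h1 h0 h2
  rw [sub_self] at h3
  by_contra hne
  have : 0 < ψ xbar * ‖lsqGrad Φ b xbar‖ ^ 2 := by
    have := norm_pos_iff.2 hne
    positivity
  linarith

end Steps

/-- At a stationary point whose residual form is smaller than `2 l² ‖x‖²` the Hessian is positive
definite, so that the objective grows quadratically. -/
lemma IsComparable.quadratic_growth (h : IsComparable Φ l L) {xbar : E} {S : ℝ}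
    (hstat : ∀ w, ⟪Φ xbar xbar - b, Φ xbar w⟫ = 0)
    (hS : ∀ u v, |⟪Φ xbar xbar - b, Φ u v⟫| ≤ S * ‖u‖ * ‖v‖) (hlt : S < 2 * l ^ 2 * ‖xbar‖ ^ 2) :
    ∃ κ ρ : ℝ, 0 < κ ∧ 0 < ρ ∧ ∀ z, ‖z - xbar‖ ≤ ρ →
      κ * ‖z - xbar‖ ^ 2 ≤ lsq Φ b z - lsq Φ b xbar := by
  have hL := h.L_pos
  set γ := 2 * l ^ 2 * ‖xbar‖ ^ 2 - S with hγ
  have hγ0 : 0 < γ := by rw [hγ]; linarith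
  refine ⟨γ / 4, γ / (4 * (L ^ 2 * ‖xbar‖ + 1)), by positivity, by positivity, fun z hz => ?_⟩
  obtain ⟨w, rfl⟩ : ∃ w, z = xbar + w := ⟨z - xbar, by abel⟩
  rw [add_sub_cancel_left] at hz ⊢
  rw [lsq_add h.symm, hstat]
  have h1 := h.le_norm_sq xbar w
  have h2 := neg_le_of_abs_le (hS w w)
  have h3 := neg_le_of_abs_le (h.abs_inner_le xbar w w w)
  have h4 : 0 ≤ ‖Φ w w‖ ^ 2 := by positivity
  rw [le_div_iff₀ (by positivity)] at hz
  have h5 : (‖w‖ * (4 * (L ^ 2 * ‖xbar‖ + 1))) * ‖w‖ ^ 2 ≤ γ * ‖w‖ ^ 2 := by gcongr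
  have h6 : 0 ≤ ‖w‖ ^ 3 := by positivity
  have h7 : γ * ‖w‖ ^ 2 = (2 * l ^ 2 * ‖xbar‖ ^ 2) * ‖w‖ ^ 2 - S * ‖w‖ ^ 2 := by rw [hγ]; ring
  nlinarith

/-! ### Local rate -/

section Rate

variable [CompleteSpace E] [CompleteSpace F]

/-- The error of a full regularized Newton step: it is governed by the part of the Hessian that the
Gauss-Newton matrix omits, by the regularization, and by a quadratic term. -/
lemma IsNewtonDir.full_step_error (h : IsComparable Φ l L) {xbar x d : E} {S σ : ℝ} (hσ : 0 ≤ σ)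
    (hstat : ∀ w, ⟪Φ xbar xbar - b, Φ xbar w⟫ = 0)
    (hS : ∀ u v, |⟪Φ xbar xbar - b, Φ u v⟫| ≤ S * ‖u‖ * ‖v‖) (hd : IsNewtonDir Φ b σ x d) :
    2 * l ^ 2 * ‖x‖ ^ 2 * ‖x + d - xbar‖ ≤
      (S + σ + L ^ 2 * ‖x‖ * ‖x - xbar‖) * ‖x - xbar‖ := by
  obtain ⟨e, rfl⟩ : ∃ e, xbar = x - e := ⟨x - xbar, by abel⟩
  have ew : x + d - (x - e) = e + d := by abel
  rw [ew, sub_sub_cancel]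
  set w := e + d with hw
  rcases (norm_nonneg w).eq_or_lt with h0 | h0
  · rw [← h0, mul_zero]
    have hL := h.L_pos
    have : 0 ≤ S * ‖e‖ * ‖e‖ := (abs_nonneg _).trans (hS e e)
    have : 0 ≤ (σ + L ^ 2 * ‖x‖ * ‖e‖) * ‖e‖ := by positivity
    rcases (norm_nonneg e).eq_or_lt with h1 | h1
    · rw [← h1]; simp
    · nlinarith
  -- the Newton equation, with the gradient expanded at `xbar = x - e` and tested with `w`
  have key : 2 * ‖Φ x w‖ ^ 2 + σ * ‖w‖ ^ 2 =
      σ * ⟪e, w⟫ - ⟪Φ (x - e) (x - e) - b, Φ e w⟫ + ⟪Φ e e, Φ x w⟫ := by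
    have h1 := hd w
    have h2 := hstat w
    rw [inner_lsqGrad] at h1
    have h3 : Φ x x - b = (Φ (x - e) (x - e) - b) + (2 : ℝ) • Φ x e - Φ e e := by
      simp only [map_sub, sub_apply, h.symm e x]
      module
    have h4 : ⟪Φ (x - e) (x - e) - b, Φ x w⟫ = ⟪Φ (x - e) (x - e) - b, Φ e w⟫ := by
      have : Φ x w = Φ (x - e) w + Φ e w := by simp
      rw [this, inner_add_right, h2, zero_add]
    have h5 : ⟪Φ x x - b, Φ x w⟫ =
        ⟪Φ (x - e) (x - e) - b, Φ e w⟫ + 2 * ⟪Φ x e, Φ x w⟫ - ⟪Φ e e, Φ x w⟫ := by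
      rw [h3, inner_sub_left, inner_add_left, h4, real_inner_smul_left]
    have h6 : ‖Φ x w‖ ^ 2 = ⟪Φ x e, Φ x w⟫ + ⟪Φ x d, Φ x w⟫ := by
      rw [← real_inner_self_eq_norm_sq, ← inner_add_left, ← map_add]
    have h7 : ‖w‖ ^ 2 = ⟪e, w⟫ + ⟪d, w⟫ := by
      rw [← real_inner_self_eq_norm_sq, ← inner_add_left]
    rw [h6, h7]
    linarith
  have k1 := h.le_norm_sq x w
  have k2 := mul_le_mul_of_nonneg_left (le_of_abs_le (abs_real_inner_le_norm e w)) hσ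
  have k3 := neg_le_of_abs_le (hS e w)
  have k4 := le_of_abs_le (h.abs_inner_le e e x w)
  have k5 : 0 ≤ σ * ‖w‖ ^ 2 := by positivity
  refine le_of_mul_le_mul_right ?_ h0
  nlinarith

/-- Where the residual form is small, the full Newton step passes the Armijo test. -/
lemma IsNewtonDir.armijoStep_eq_one (h : IsComparable Φ l L) {xbar x d : E} {S σ α μ : ℝ}
    (hσ : 0 ≤ σ) (hx : x ≠ 0) (hμ : μ ∈ Set.Ioo (0 : ℝ) (1 / 2))
    (hS : ∀ u v, |⟪Φ xbar xbar - b, Φ u v⟫| ≤ S * ‖u‖ * ‖v‖) (hd : IsNewtonDir Φ b σ x d)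
    (hsmall : (S + L * ‖Φ x x - Φ xbar xbar‖) / 2 + L ^ 2 * ‖x‖ * newtonLength Φ b l x
      + L ^ 2 * newtonLength Φ b l x ^ 2 / 4 ≤ (1 / 2 - μ) * (2 * l ^ 2 * ‖x‖ ^ 2)) :
    armijoStep (lsq Φ b) α μ x d ⟪lsqGrad Φ b x, d⟫ = 1 := by
  have hL := h.L_pos
  have hacc : lsq Φ b (x + d) ≤ lsq Φ b x + μ * ⟪lsqGrad Φ b x, d⟫ := by
    have hdn := hd.norm_le h hσ hx
    rw [lsq_add h.symm, ← inner_lsqGrad]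
    have h1 := hd.inner_grad
    have h2 := hd.inner_grad_le h hσ
    have h3 : ⟪Φ x x - b, Φ d d⟫ ≤ (S + L * ‖Φ x x - Φ xbar xbar‖) * ‖d‖ ^ 2 := by
      have e : Φ x x - b = (Φ xbar xbar - b) + (Φ x x - Φ xbar xbar) := by abel
      rw [e, inner_add_left]
      have a1 := le_of_abs_le (hS d d)
      have a2 := le_of_abs_le (h.abs_inner_residual_le (Φ x x - Φ xbar xbar) d d)
      linarith
    have h4 := le_of_abs_le (h.abs_inner_le x d d d)
    have h5 := h.norm_sq_le d d
    have h6 : L ^ 2 * ‖x‖ * ‖d‖ * ‖d‖ ^ 2 ≤ L ^ 2 * ‖x‖ * newtonLength Φ b l x * ‖d‖ ^ 2 := by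
      gcongr
    have h7 : L ^ 2 * ‖d‖ ^ 2 * ‖d‖ ^ 2 ≤ L ^ 2 * newtonLength Φ b l x ^ 2 * ‖d‖ ^ 2 := by
      gcongr
    have h8 := mul_le_mul_of_nonneg_right hsmall (sq_nonneg ‖d‖)
    have h9 : (1 / 2 - μ) * (2 * l ^ 2 * ‖x‖ ^ 2 * ‖d‖ ^ 2) ≤
        (1 / 2 - μ) * (-⟪lsqGrad Φ b x, d⟫) := by
      have : 0 < 1 / 2 - μ := by linarith [hμ.2]
      gcongr; linarith
    have h10 : 0 ≤ σ * ‖d‖ ^ 2 := by positivity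
    nlinarith
  have : sInf {j : ℕ | lsq Φ b (x + α ^ j • d) ≤
      lsq Φ b x + μ * α ^ j * ⟪lsqGrad Φ b x, d⟫} = 0 := by
    rw [Nat.sInf_eq_zero]
    left
    simpa using hacc
  rw [armijoStep, this, pow_zero]

/-- Newton steps near a stationary point contract the error by any factor larger than
`S / (2 l² ‖xbar‖²)`, where `S` bounds the residual form, provided the full step is accepted. -/
lemma IsComparable.eventually_contraction (h : IsComparable Φ l L) {xbar : E} {S β δ α μ η : ℝ}
    (hβ : 0 < β) (hδ : 0 < δ) (hμ : μ ∈ Set.Ioo (0 : ℝ) (1 / 2)) (hx : xbar ≠ 0)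
    (hstat : lsqGrad Φ b xbar = 0)
    (hS : ∀ u v, |⟪Φ xbar xbar - b, Φ u v⟫| ≤ S * ‖u‖ * ‖v‖)
    (hS1 : S / 2 < (1 / 2 - μ) * (2 * l ^ 2 * ‖xbar‖ ^ 2))
    (hS2 : S < η * (2 * l ^ 2 * ‖xbar‖ ^ 2)) :
    ∀ᶠ x in 𝓝 xbar, ∀ y, IsNewtonStep Φ b β δ α μ x y → ‖y - xbar‖ ≤ η * ‖x - xbar‖ := by
  have hl := h.l_pos
  have hstat' : ∀ w, ⟪Φ xbar xbar - b, Φ xbar w⟫ = 0 := fun w => by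
    rw [← inner_lsqGrad, hstat, inner_zero_left]
  have hlen : newtonLength Φ b l xbar = 0 := by simp [newtonLength, hstat]
  have hlenc := h.continuousAt_newtonLength (b := b) hx
  have hg := continuousAt_norm_lsqGrad_rpow (Φ := Φ) (b := b) hδ.le xbar
  have e1 : ∀ᶠ x in 𝓝 xbar, (S + L * ‖Φ x x - Φ xbar xbar‖) / 2 +
      L ^ 2 * ‖x‖ * newtonLength Φ b l x + L ^ 2 * newtonLength Φ b l x ^ 2 / 4 <
        (1 / 2 - μ) * (2 * l ^ 2 * ‖x‖ ^ 2) := by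
    refine ContinuousAt.eventually_lt (by fun_prop) (by fun_prop) ?_
    simpa [hlen] using hS1
  have e2 : ∀ᶠ x in 𝓝 xbar, S + β * ‖lsqGrad Φ b x‖ ^ δ + L ^ 2 * ‖x‖ * ‖x - xbar‖ <
      η * (2 * l ^ 2 * ‖x‖ ^ 2) := by
    refine ContinuousAt.eventually_lt (by fun_prop) (by fun_prop) ?_
    simpa [hstat, hδ.ne'] using hS2
  filter_upwards [e1, e2, isOpen_ne.mem_nhds hx] with x h1 h2 h3 y hy
  obtain ⟨d, hd, -, rfl⟩ := hy
  have hσ : 0 ≤ β * ‖lsqGrad Φ b x‖ ^ δ := by positivity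
  rw [hd.armijoStep_eq_one h hσ h3 hμ hS h1.le, one_smul]
  have h4 := hd.full_step_error h hσ hstat' hS
  have hx' : 0 < ‖x‖ := norm_pos_iff.2 h3
  have h5 : 0 < 2 * l ^ 2 * ‖x‖ ^ 2 := by positivity
  refine le_of_mul_le_mul_left ?_ h5
  calc _ ≤ _ := h4
    _ ≤ η * (2 * l ^ 2 * ‖x‖ ^ 2) * ‖x - xbar‖ := by gcongr
    _ = _ := by ring

end Rate

/-! ### Identification of stationary points -/

/-- **Identification.** Let the observation be `Φ x* x* + e`. With `z` the component of `x*`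
orthogonal to `xbar`, stationarity gives
`‖Φ u v‖² = ⟨e, Φ u v⟩ - ⟨ρ, Φ z z⟩` for `u = xbar - x*`, `v = xbar + x*` and the residual `ρ`,
while `‖u‖ ‖v‖ ≥ 2 ‖xbar‖ ‖z‖`. So the residual form absorbs at most half of the left side, and the
error `‖u‖ ‖v‖` is of the size of the noise form. -/
lemma IsComparable.error_le_of_stationary (h : IsComparable Φ l L) {xbar xs : E} {e : F} {S τ : ℝ}
    (hx : xbar ≠ 0) (hb : b = Φ xs xs + e)
    (hstat : ∀ w, ⟪Φ xbar xbar - b, Φ xbar w⟫ = 0)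
    (hS : ∀ u v, |⟪Φ xbar xbar - b, Φ u v⟫| ≤ S * ‖u‖ * ‖v‖) (hlt : S ≤ 2 * l ^ 2 * ‖xbar‖ ^ 2)
    (he : ∀ u v, |⟪e, Φ u v⟫| ≤ τ * ‖u‖ * ‖v‖) :
    l ^ 2 * (‖xbar - xs‖ * ‖xbar + xs‖) ≤ 2 * τ := by
  have hl := h.l_pos
  have hx' : 0 < ‖xbar‖ := norm_pos_iff.2 hx
  set t := ⟪xbar, xs⟫ / ‖xbar‖ ^ 2 with ht
  obtain ⟨z, hz⟩ : ∃ z, z = xs - t • xbar := ⟨_, rfl⟩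
  have hxs : xs = t • xbar + z := by rw [hz]; abel
  have hzo : ⟪xbar, z⟫ = 0 := by
    rw [hz, inner_sub_right, inner_smul_right, real_inner_self_eq_norm_sq, ht]
    field_simp
    ring
  set u := xbar - xs with hu
  set v := xbar + xs with hv
  set ρ := Φ xbar xbar - b with hρ
  have huv : Φ u v = Φ xbar xbar - Φ xs xs := by
    rw [hu, hv]
    simp only [map_sub, map_add, sub_apply, h.symm xs xbar]
    abel
  have huv' : Φ u v = ρ + e := by rw [huv, hρ, hb]; abel
  have hρs : ⟪ρ, Φ xs xs⟫ = ⟪ρ, Φ z z⟫ := by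
    have : Φ xs xs = Φ xbar (t ^ 2 • xbar + (2 * t) • z) + Φ z z := by
      rw [hxs]
      simp only [map_add, map_smul, add_apply, smul_apply, h.symm z xbar]
      module
    rw [this, inner_add_right, hstat, zero_add]
  have hid : ‖Φ u v‖ ^ 2 = ⟪e, Φ u v⟫ - ⟪ρ, Φ z z⟫ := by
    rw [← real_inner_self_eq_norm_sq]
    nth_rewrite 1 [huv']
    rw [inner_add_left, huv, inner_sub_right, hstat, hρs]
    ring
  have hun : ‖u‖ ^ 2 = (1 - t) ^ 2 * ‖xbar‖ ^ 2 + ‖z‖ ^ 2 := by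
    have : u = (1 - t) • xbar - z := by rw [hu, hxs]; module
    rw [this, norm_sub_sq_real, real_inner_smul_left, hzo, norm_smul, mul_pow, Real.norm_eq_abs,
      sq_abs]
    ring
  have hvn : ‖v‖ ^ 2 = (1 + t) ^ 2 * ‖xbar‖ ^ 2 + ‖z‖ ^ 2 := by
    have : v = (1 + t) • xbar + z := by rw [hv, hxs]; module
    rw [this, norm_add_sq_real, real_inner_smul_left, hzo, norm_smul, mul_pow, Real.norm_eq_abs,
      sq_abs]
    ring
  set q := ‖u‖ * ‖v‖ with hq
  have hq0 : 0 ≤ q := by positivity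
  have hq4 : 4 * (‖xbar‖ ^ 2 * ‖z‖ ^ 2) ≤ q ^ 2 := by
    -- the difference of the two sides is a perfect square
    have : q ^ 2 - 4 * (‖xbar‖ ^ 2 * ‖z‖ ^ 2) =
        ((1 - t ^ 2) * ‖xbar‖ ^ 2 - ‖z‖ ^ 2) ^ 2 := by
      rw [hq, mul_pow, hun, hvn]; ring
    nlinarith [sq_nonneg ((1 - t ^ 2) * ‖xbar‖ ^ 2 - ‖z‖ ^ 2)]
  have h1 := h.le_norm_sq u v
  have h2 := le_of_abs_le (he u v)
  have h3 := neg_le_of_abs_le (hS z z)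
  have h4 : S * ‖z‖ * ‖z‖ ≤ 2 * l ^ 2 * ‖xbar‖ ^ 2 * ‖z‖ * ‖z‖ := by gcongr
  have h5 : l ^ 2 * (4 * (‖xbar‖ ^ 2 * ‖z‖ ^ 2)) ≤ l ^ 2 * q ^ 2 := by gcongr
  -- by `h5`, the term `2 l² ‖xbar‖² ‖z‖²` in `h4` is at most half of `l² q²`
  have h6 : l ^ 2 * q * q ≤ 2 * τ * q := by
    have : l ^ 2 * q * q = l ^ 2 * ‖u‖ ^ 2 * ‖v‖ ^ 2 := by rw [hq]; ring
    have : τ * q = τ * ‖u‖ * ‖v‖ := by rw [hq]; ring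
    nlinarith
  rcases hq0.eq_or_lt with h0 | h0
  · rw [← h0, mul_zero]
    have := (abs_nonneg _).trans (he xbar xbar)
    have : 0 ≤ τ := by
      by_contra hneg
      have : τ * ‖xbar‖ * ‖xbar‖ < 0 := by
        have := mul_pos hx' hx'
        nlinarith
      linarith
    linarith
  · exact le_of_mul_le_mul_right h6 h0

/-- The residual form at an identified stationary point is of the size of the noise form. -/
lemma IsComparable.residual_le_of_error (h : IsComparable Φ l L) {xbar xs : E} {e : F} {q τ : ℝ}
    (hb : b = Φ xs xs + e) (hq : ‖xbar - xs‖ * ‖xbar + xs‖ ≤ q)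
    (he : ∀ u v, |⟪e, Φ u v⟫| ≤ τ * ‖u‖ * ‖v‖) (u v : E) :
    |⟪Φ xbar xbar - b, Φ u v⟫| ≤ (L ^ 2 * q + τ) * ‖u‖ * ‖v‖ := by
  have e1 : Φ xbar xbar - b = Φ (xbar - xs) (xbar + xs) - e := by
    rw [hb]
    simp only [map_sub, map_add, sub_apply, h.symm xs xbar]
    abel
  rw [e1, inner_sub_left]
  calc _ ≤ |⟪Φ (xbar - xs) (xbar + xs), Φ u v⟫| + |⟪e, Φ u v⟫| := abs_sub _ _
    _ ≤ L ^ 2 * (‖xbar - xs‖ * ‖xbar + xs‖) * ‖u‖ * ‖v‖ + τ * ‖u‖ * ‖v‖ := by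
        have := h.abs_inner_le (xbar - xs) (xbar + xs) u v
        have := he u v
        linarith
    _ ≤ L ^ 2 * q * ‖u‖ * ‖v‖ + τ * ‖u‖ * ‖v‖ := by gcongr
    _ = _ := by ring

lemma sub_norm_sq_le (x y : E) : ‖y‖ ^ 2 - ‖x‖ ^ 2 ≤ ‖x - y‖ * ‖x + y‖ := by
  have h1 := neg_le_of_abs_le (abs_real_inner_le_norm (x - y) (x + y))
  have h2 : ⟪x - y, x + y⟫ = ‖x‖ ^ 2 - ‖y‖ ^ 2 := by
    rw [inner_sub_left, inner_add_right, inner_add_right, real_inner_self_eq_norm_sq,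
      real_inner_self_eq_norm_sq, real_inner_comm y x]
    ring
  linarith

end Bilinear

/-! ### The quadratic model as a bilinear least squares problem -/

section Model

variable {n p : ℕ} {A : Fin n → Matrix (Fin p) (Fin p) ℝ} {b : Fin n → ℝ} {c : Params}
  {lam Lam : ℝ}

lemma act_add (M : Matrix (Fin p) (Fin p) ℝ) (u v : Vec p) :
    act M (u + v) = act M u + act M v := map_add _ _ _

lemma act_smul (M : Matrix (Fin p) (Fin p) ℝ) (s : ℝ) (v : Vec p) :
    act M (s • v) = s • act M v := map_smul _ _ _

/-- The normalization `n^{-1/2} y` of a vector of `n` measurements; for `n = 0` it is the only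
vector there is. -/
noncomputable def normalize (y : Fin n → ℝ) : EuclideanSpace ℝ (Fin n) :=
  (√(n : ℝ))⁻¹ • WithLp.toLp 2 y

lemma inner_normalize (y z : Fin n → ℝ) :
    ⟪normalize y, normalize z⟫ = (1 / (n : ℝ)) * ∑ i, y i * z i := by
  rw [normalize, normalize, real_inner_smul_left, inner_smul_right, ← mul_assoc, ← mul_inv,
    Real.mul_self_sqrt (Nat.cast_nonneg n), one_div, PiLp.inner_apply]
  simp [mul_comm]

lemma norm_normalize_sq (y : Fin n → ℝ) :
    ‖normalize y‖ ^ 2 = (1 / (n : ℝ)) * ∑ i, y i ^ 2 := by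
  rw [← real_inner_self_eq_norm_sq, inner_normalize]
  simp [sq]

/-- The bilinear map `(u, v) ↦ n^{-1/2} (⟨u, Aᵢ v⟩)ᵢ`. -/
noncomputable def designForm (A : Fin n → Matrix (Fin p) (Fin p) ℝ) :
    Vec p →L[ℝ] Vec p →L[ℝ] EuclideanSpace ℝ (Fin n) :=
  (LinearMap.mk₂ ℝ (fun u v : Vec p => normalize fun i => inner ℝ u (act (A i) v))
    (fun u u' v => by ext i; simp [normalize, inner_add_left, mul_add])
    (fun s u v => by ext i; simp [normalize, real_inner_smul_left]; ring)
    (fun u v v' => by ext i; simp [normalize, act_add, inner_add_right, mul_add])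
    (fun s u v => by ext i; simp [normalize, act_smul, inner_smul_right]; ring)
    ).toContinuousBilinearMap

lemma designForm_apply (u v : Vec p) :
    designForm A u v = normalize fun i => inner ℝ u (act (A i) v) := rfl

lemma inner_act_comm {M : Matrix (Fin p) (Fin p) ℝ} (hM : M.IsSymm) (u v : Vec p) :
    inner ℝ u (act M v) = inner ℝ v (act M u) := by
  simp only [act, Matrix.inner_toEuclideanCLM]
  rw [Matrix.dotProduct_mulVec, ← Matrix.mulVec_transpose, hM.eq, dotProduct_comm]

lemma isComparable_designForm (hlam : 0 < lam) (hLam : 0 < Lam) (hs : ∀ i, (A i).IsSymm)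
    (hA : IsometryBounds A lam Lam) : IsComparable (designForm A) (√lam) (√Lam) where
  l_pos := Real.sqrt_pos.2 hlam
  L_pos := Real.sqrt_pos.2 hLam
  symm u v := by
    simp only [designForm_apply]
    congr 1
    funext i
    exact inner_act_comm (hs i) u v
  lower u v := by
    refine le_of_sq_le_sq ?_ (norm_nonneg _)
    rw [designForm_apply, norm_normalize_sq, mul_pow, mul_pow, Real.sq_sqrt hlam.le]
    exact (hA u v).1
  upper u v := by
    refine le_of_sq_le_sq ?_ (by positivity)
    rw [designForm_apply, norm_normalize_sq, mul_pow, mul_pow, Real.sq_sqrt hLam.le]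
    exact (hA u v).2

lemma residual_eq (x : Vec p) :
    designForm A x x - normalize b = normalize fun i => residual A b i x := by
  ext i
  simp [designForm_apply, normalize, residual, mul_sub]

lemma objective_eq : objective A b = lsq (designForm A) (normalize b) := by
  funext x
  rw [lsq, residual_eq, norm_normalize_sq, objective]
  ring

lemma grad_eq (hlam : 0 < lam) (hLam : 0 < Lam) (hs : ∀ i, (A i).IsSymm)
    (hA : IsometryBounds A lam Lam) (x : Vec p) :
    grad A b x = lsqGrad (designForm A) (normalize b) x := by
  rw [grad, objective_eq]
  exact ((isComparable_designForm hlam hLam hs hA).hasGradientAt_lsq x).gradient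

lemma act_sum_smul (y : Fin n → ℝ) (v : Vec p) :
    act (∑ i, y i • A i) v = ∑ i, y i • act (A i) v := by
  simp [act, map_sum]

lemma inner_act_residualMatrix (x u v : Vec p) :
    inner ℝ u (act (residualMatrix A b x) v) =
      ⟪designForm A x x - normalize b, designForm A u v⟫ := by
  rw [residual_eq, designForm_apply, inner_normalize, residualMatrix]
  have : act ((1 / (n : ℝ)) • ∑ i, residual A b i x • A i) v =
      (1 / (n : ℝ)) • ∑ i, residual A b i x • act (A i) v := by
    rw [← act_sum_smul]; simp [act]
  rw [this, inner_smul_right, inner_sum]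
  simp [inner_smul_right]

lemma inner_act_gaussNewton (hs : ∀ i, (A i).IsSymm) (x u v : Vec p) :
    inner ℝ u (act (gaussNewton A x) v) = 2 * ⟪designForm A x u, designForm A x v⟫ := by
  have hrow : ∀ w : Vec p, (rowMatrix A x).mulVec w.ofLp = fun i => inner ℝ x (act (A i) w) := by
    intro w
    funext i
    rw [inner_act_comm (hs i), PiLp.inner_apply]
    simp [rowMatrix, Matrix.mulVec, dotProduct, mul_comm]
  rw [designForm_apply, designForm_apply, inner_normalize, act, Matrix.inner_toEuclideanCLM,
    gaussNewton, Matrix.smul_mulVec, dotProduct_smul, ← Matrix.mulVec_mulVec,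
    Matrix.dotProduct_mulVec, Matrix.vecMul_transpose, hrow, hrow]
  simp only [dotProduct, smul_eq_mul]
  ring

/-- The spectral norm of the residual matrix bounds the residual form. -/
lemma abs_inner_residual_le_specNorm (x u v : Vec p) :
    |⟪designForm A x x - normalize b, designForm A u v⟫| ≤
      specNorm (residualMatrix A b x) * ‖u‖ * ‖v‖ := by
  rw [← inner_act_residualMatrix]
  calc _ ≤ ‖u‖ * ‖act (residualMatrix A b x) v‖ := abs_real_inner_le_norm _ _
    _ ≤ ‖u‖ * (specNorm (residualMatrix A b x) * ‖v‖) := by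
        gcongr
        exact ContinuousLinearMap.le_opNorm _ _
    _ = _ := by ring

/-! ### The iterates of the method -/

lemma isGradStep_gradStep (hlam : 0 < lam) (hLam : 0 < Lam) (hs : ∀ i, (A i).IsSymm)
    (hA : IsometryBounds A lam Lam) (x : Vec p) :
    IsGradStep (designForm A) (normalize b) c.α₁ c.μ₁ x (gradStep A b c x) := by
  rw [IsGradStep, ← grad_eq hlam hLam hs hA, ← objective_eq, armijoStep, gradStep]
  simp only [smul_neg, inner_neg_right, real_inner_self_eq_norm_sq, mul_neg, ← sub_eq_add_neg]

/-- The direction computed with the matrix inverse solves the Newton equation. At `x = 0` the matrix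
is singular, but there the gradient vanishes too. -/
lemma isNewtonDir_newtonDir (hlam : 0 < lam) (hLam : 0 < Lam) (hs : ∀ i, (A i).IsSymm)
    (hA : IsometryBounds A lam Lam) (x : Vec p) :
    IsNewtonDir (designForm A) (normalize b)
      (c.β * ‖lsqGrad (designForm A) (normalize b) x‖ ^ c.δ) x (newtonDir A b c x) := by
  have h := isComparable_designForm hlam hLam hs hA
  have hg := grad_eq (b := b) hlam hLam hs hA x
  rw [← hg]
  by_cases hx : x = 0
  · intro w
    have h0 : grad A b x = 0 := by rw [hg, hx, lsqGrad_zero]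
    rw [← hg, newtonDir, h0, hx, norm_zero, Real.zero_rpow c.δ_mem.1.ne']
    simp [act]
  have hx' : 0 < ‖x‖ := norm_pos_iff.2 hx
  set σ := c.β * ‖grad A b x‖ ^ c.δ with hσ
  have hσ0 : 0 ≤ σ := by have := c.β_pos; positivity
  set B := gaussNewton A x + σ • (1 : Matrix (Fin p) (Fin p) ℝ) with hB
  have hBi : ∀ u v : Vec p, inner ℝ u (act B v) =
      2 * ⟪designForm A x u, designForm A x v⟫ + σ * ⟪u, v⟫ := by
    intro u v
    have : act B v = act (gaussNewton A x) v + σ • v := by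
      rw [hB]; simp [act]
    rw [this, inner_add_right, inner_act_gaussNewton hs, inner_smul_right]
  -- `H(x)` is positive definite for `x ≠ 0`, so the regularized matrix is invertible
  have hinj : ∀ v : Vec p, act B v = 0 → v = 0 := by
    intro v hv
    have h1 := hBi v v
    rw [hv, inner_zero_right, real_inner_self_eq_norm_sq, real_inner_self_eq_norm_sq] at h1
    have h2 := h.le_norm_sq x v
    rw [Real.sq_sqrt hlam.le] at h2
    have h3 : 0 ≤ σ * ‖v‖ ^ 2 := by positivity
    have h4 : lam * ‖x‖ ^ 2 * ‖v‖ ^ 2 ≤ 0 := by linarith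
    by_contra hne
    have := norm_pos_iff.2 hne
    have : 0 < lam * ‖x‖ ^ 2 * ‖v‖ ^ 2 := by positivity
    linarith
  have hdet : IsUnit B.det := by
    rw [isUnit_iff_ne_zero]
    intro h0
    obtain ⟨v, hv, hBv⟩ := Matrix.exists_mulVec_eq_zero_iff.2 h0
    apply hv
    have := hinj (WithLp.toLp 2 v) (by
      rw [act, Matrix.toEuclideanCLM_toLp, hBv]; rfl)
    simpa using this
  have hd : act B (newtonDir A b c x) = -grad A b x := by
    rw [newtonDir]
    simp only [act, map_neg, ← mul_apply_eq_comp, ← map_mul]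
    rw [Matrix.mul_nonsing_inv _ hdet]
    simp
  intro w
  have h1 := hBi w (newtonDir A b c x)
  rw [hd, inner_neg_right, real_inner_comm (grad A b x), hg] at h1
  rw [real_inner_comm, real_inner_comm w, ← h1]

lemma isNewtonStep_newtonStep (hlam : 0 < lam) (hLam : 0 < Lam) (hs : ∀ i, (A i).IsSymm)
    (hA : IsometryBounds A lam Lam) (x : Vec p) :
    IsNewtonStep (designForm A) (normalize b) c.β c.δ c.α₂ c.μ₂ x (newtonStep A b c x) := by
  refine ⟨newtonDir A b c x, isNewtonDir_newtonDir hlam hLam hs hA x, fun hx => ?_, ?_⟩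
  · have h0 : grad A b x = 0 := by rw [grad_eq hlam hLam hs hA, hx, lsqGrad_zero]
    simp [newtonDir, h0, act]
  · rw [← grad_eq hlam hLam hs hA, ← objective_eq, armijoStep, newtonStep]

lemma phase_antitone (x₀ : Vec p) : Antitone fun k => (grnmState A b c x₀ k).2 :=
  antitone_nat_of_succ_le fun k h => by
    simp only [grnmState] at h
    exact h.1

lemma le_norm_grad_of_phase {x₀ : Vec p} {k : ℕ} (h : (grnmState A b c x₀ k).2) :
    c.ε₁ ≤ ‖grad A b (grnm A b c x₀ k)‖ := by
  cases k with
  | zero => exact h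
  | succ k => exact h.2

/-- Either the first phase never ends, or all steps from some index on are Newton steps. -/
lemma grnm_cases (A : Fin n → Matrix (Fin p) (Fin p) ℝ) (b : Fin n → ℝ) (c : Params)
    (x₀ : Vec p) :
    (∀ k, c.ε₁ ≤ ‖grad A b (grnm A b c x₀ k)‖ ∧
      grnm A b c x₀ (k + 1) = gradStep A b c (grnm A b c x₀ k)) ∨
    ∃ K, ∀ k, K ≤ k → grnm A b c x₀ (k + 1) = newtonStep A b c (grnm A b c x₀ k) := by
  by_cases h : ∀ k, (grnmState A b c x₀ k).2
  · left
    refine fun k => ⟨le_norm_grad_of_phase (h k), ?_⟩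
    simp [grnm, grnmState, h k]
  · right
    push Not at h
    obtain ⟨K, hK⟩ := h
    refine ⟨K, fun k hk => ?_⟩
    have : ¬ (grnmState A b c x₀ k).2 := fun h' => hK (phase_antitone x₀ hk h')
    simp [grnm, grnmState, this]

/-- An accumulation point other than `0` is stationary and is reached by Newton steps. -/
lemma stationary_of_mapClusterPt (hlam : 0 < lam) (hLam : 0 < Lam) (hs : ∀ i, (A i).IsSymm)
    (hA : IsometryBounds A lam Lam) {x₀ xbar : Vec p} (hx : xbar ≠ 0)
    (hacc : MapClusterPt xbar atTop (grnm A b c x₀)) :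
    lsqGrad (designForm A) (normalize b) xbar = 0 ∧ ∃ K,
      (∀ k, IsNewtonStep (designForm A) (normalize b) c.β c.δ c.α₂ c.μ₂
        (grnm A b c x₀ (k + K)) (grnm A b c x₀ (k + 1 + K))) ∧
      MapClusterPt xbar atTop fun k => grnm A b c x₀ (k + K) := by
  have h := isComparable_designForm hlam hLam hs hA
  rcases grnm_cases A b c x₀ with h1 | ⟨K, hK⟩
  · exfalso
    have hstep : ∀ k, lsq (designForm A) (normalize b) (grnm A b c x₀ (k + 1)) ≤
        lsq (designForm A) (normalize b) (grnm A b c x₀ k) -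
          gradDecrease (designForm A) (normalize b) (√Lam) c.α₁ c.μ₁ (grnm A b c x₀ k) *
            ‖lsqGrad (designForm A) (normalize b) (grnm A b c x₀ k)‖ ^ 2 := fun k => by
      rw [(h1 k).2]
      exact h.gradStep_decrease c.α₁_mem c.μ₁_mem (isGradStep_gradStep hlam hLam hs hA _)
    have hpos := fun x => h.gradDecrease_pos (b := normalize b) c.α₁_mem c.μ₁_mem x
    have h0 := lsqGrad_eq_zero_of_decrease hacc
      (antitone_nat_of_succ_le fun k => by
        have := hstep k
        have := mul_nonneg (hpos (grnm A b c x₀ k)).le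
          (sq_nonneg ‖lsqGrad (designForm A) (normalize b) (grnm A b c x₀ k)‖)
        linarith)
      (h.continuousAt_gradDecrease xbar) (hpos xbar)
      (Eventually.of_forall fun z k hk => by rw [← hk]; exact hstep k)
    -- the gradient is at least `ε₁` along the sequence, hence also at the accumulation point
    obtain ⟨φ, -, hlim⟩ := hacc.tendsto_subseq
    have h2 := ge_of_tendsto ((continuous_lsqGrad.norm.tendsto xbar).comp hlim)
      (Eventually.of_forall fun k => by
        have := (h1 (φ k)).1
        rw [grad_eq hlam hLam hs hA] at this
        exact this)
    rw [h0, norm_zero] at h2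
    linarith [c.ε₁_pos]
  · have hstep : ∀ k, IsNewtonStep (designForm A) (normalize b) c.β c.δ c.α₂ c.μ₂
        (grnm A b c x₀ (k + K)) (grnm A b c x₀ (k + 1 + K)) := fun k => by
      rw [show k + 1 + K = k + K + 1 by ring, hK _ (by omega)]
      exact isNewtonStep_newtonStep hlam hLam hs hA _
    have hacc' : MapClusterPt xbar atTop fun k => grnm A b c x₀ (k + K) := by
      rw [MapClusterPt, show (fun k => grnm A b c x₀ (k + K)) = grnm A b c x₀ ∘ (· + K) from rfl,
        ← Filter.map_map, map_add_atTop_eq_nat]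
      exact hacc
    refine ⟨?_, K, hstep, hacc'⟩
    refine lsqGrad_eq_zero_of_decrease (b := normalize b) (ψ := newtonDecrease (designForm A)
      (normalize b) (√lam) (√Lam) c.β c.δ c.α₂ c.μ₂) hacc'
      (antitone_nat_of_succ_le fun k => h.newtonStep_le c.β_pos c.α₂_mem c.μ₂_mem (hstep k))
      (h.continuousAt_newtonDecrease c.β_pos c.δ_mem.1.le hx)
      (h.newtonDecrease_pos c.β_pos c.α₂_mem c.μ₂_mem hx) ?_
    filter_upwards [isOpen_ne.mem_nhds hx] with z hz k hk
    rw [← hk] at hz ⊢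
    exact (h.newtonStep_decrease c.β_pos c.α₂_mem c.μ₂_mem hz (hstep k)).1

/-- The whole sequence converges to a nonzero accumulation point at which the Hessian is positive
definite. -/
theorem tendsto_grnm (hlam : 0 < lam) (hLam : 0 < Lam) (hs : ∀ i, (A i).IsSymm)
    (hA : IsometryBounds A lam Lam) {x₀ xbar : Vec p}
    (hgood : IsGoodAccPt A b c x₀ lam xbar) : Tendsto (grnm A b c x₀) atTop (𝓝 xbar) := by
  have h := isComparable_designForm hlam hLam hs hA
  obtain ⟨hx, hacc, hlt⟩ := hgood
  obtain ⟨hstat, K, hstep, hacc'⟩ := stationary_of_mapClusterPt hlam hLam hs hA hx hacc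
  obtain ⟨κ, ρ, hκ, hρ, hgrow⟩ := h.quadratic_growth (b := normalize b) (xbar := xbar)
    (fun w => by rw [← inner_lsqGrad, hstat, inner_zero_left])
    (abs_inner_residual_le_specNorm xbar) (by rwa [Real.sq_sqrt hlam.le])
  have hD := (h.continuousAt_newtonLength (b := normalize b) hx).tendsto
  rw [show newtonLength (designForm A) (normalize b) (√lam) xbar = 0 by
    simp [newtonLength, hstat]] at hD
  refine (tendsto_add_atTop_iff_nat K).1 (tendsto_of_quadratic_growth continuous_lsq hacc'
    (antitone_nat_of_succ_le fun k => h.newtonStep_le c.β_pos c.α₂_mem c.μ₂_mem (hstep k))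
    hκ hρ hgrow hD ?_)
  filter_upwards [isOpen_ne.mem_nhds hx] with z hz k hk
  rw [← hk] at hz ⊢
  exact (h.newtonStep_decrease c.β_pos c.α₂_mem c.μ₂_mem hz (hstep k)).2

/-- A contraction in real norms bounds the extended rate; the quotients `0 / 0` are `0`. -/
lemma rate_le {x : ℕ → Vec p} {xbar : Vec p} {η : ℝ} (hη : 0 ≤ η)
    (hx : ∀ᶠ k in atTop, ‖x (k + 1) - xbar‖ ≤ η * ‖x k - xbar‖) :
    rate x xbar ≤ ENNReal.ofReal η := by
  refine limsup_le_of_le (by isBoundedDefault) ?_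
  filter_upwards [hx] with k hk
  refine ENNReal.div_le_of_le_mul ?_
  rw [← ofReal_norm, ← ofReal_norm, ← ENNReal.ofReal_mul hη]
  exact ENNReal.ofReal_le_ofReal hk

/-- If the noise form is at most `τ` with `τ` small compared with `lam`, `Lam`, the signal and the
required rate `η`, the method converges at a rate of at most `η`. -/
theorem rate_grnm_le (hlam : 0 < lam) (hLam : 0 < Lam) (hs : ∀ i, (A i).IsSymm)
    (hA : IsometryBounds A lam Lam) {xstar x₀ xbar : Vec p} {e : Fin n → ℝ} {τ η r : ℝ}
    (hr : r ≤ ‖xstar‖) (hr0 : 0 < r)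
    (hμ : c.μ₂ ∈ Set.Ioo (0 : ℝ) (1 / 2)) (hη : 0 < η) (hη1 : η ≤ 1 - 2 * c.μ₂)
    (he : ∀ u v, |⟪normalize e, designForm A u v⟫| ≤ τ * ‖u‖ * ‖v‖)
    (hτ1 : 4 * τ ≤ lam * r ^ 2) (hτ2 : (2 * Lam + lam) * τ < η * (lam ^ 2 * r ^ 2))
    (hgood : IsGoodAccPt A (observe A xstar e) c x₀ lam xbar) :
    rate (grnm A (observe A xstar e) c x₀) xbar ≤ ENNReal.ofReal η := by
  have h := isComparable_designForm hlam hLam hs hA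
  have hlim := tendsto_grnm hlam hLam hs hA hgood
  obtain ⟨hx, hacc, hlt⟩ := hgood
  obtain ⟨hstat, K, hstep, -⟩ := stationary_of_mapClusterPt hlam hLam hs hA hx hacc
  have hb : normalize (observe A xstar e) = designForm A xstar xstar + normalize e := by
    ext i
    simp [designForm_apply, normalize, observe, mul_add]
  have h1 := h.error_le_of_stationary hx hb
    (fun w => by rw [← inner_lsqGrad, hstat, inner_zero_left])
    (abs_inner_residual_le_specNorm xbar) (by rw [Real.sq_sqrt hlam.le]; exact hlt.le) he
  rw [Real.sq_sqrt hlam.le] at h1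
  have hq : ‖xbar - xstar‖ * ‖xbar + xstar‖ ≤ 2 * τ / lam := by
    rw [le_div_iff₀ hlam]; linarith
  have hS := h.residual_le_of_error hb hq he
  rw [Real.sq_sqrt hLam.le] at hS
  have hnorm : r ^ 2 / 2 ≤ ‖xbar‖ ^ 2 := by
    have h2 := sub_norm_sq_le xbar xstar
    have h3 : r ^ 2 ≤ ‖xstar‖ ^ 2 := by gcongr
    have h4 : 2 * τ / lam ≤ r ^ 2 / 2 := by
      rw [div_le_iff₀ hlam]; linarith
    linarith
  have hSlt : Lam * (2 * τ / lam) + τ < η * (2 * lam * ‖xbar‖ ^ 2) := by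
    have h2 : Lam * (2 * τ / lam) + τ = (2 * Lam + lam) * τ / lam := by field_simp
    have h3 : η * (lam * r ^ 2) ≤ η * (2 * lam * ‖xbar‖ ^ 2) := by
      refine mul_le_mul_of_nonneg_left ?_ hη.le
      nlinarith
    refine lt_of_lt_of_le ?_ h3
    rw [h2, div_lt_iff₀ hlam]
    linarith
  have hcontr := h.eventually_contraction (α := c.α₂) (η := η) c.β_pos c.δ_mem.1 hμ hx hstat hS
    (by
      rw [Real.sq_sqrt hlam.le]
      have : 0 ≤ 2 * lam * ‖xbar‖ ^ 2 := by positivity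
      have := mul_le_mul_of_nonneg_right hη1 this
      linarith)
    (by rwa [Real.sq_sqrt hlam.le])
  refine rate_le hη.le ?_
  filter_upwards [hlim.eventually hcontr, eventually_ge_atTop K] with k hk hKk
  have := hstep (k - K)
  rw [show k - K + 1 + K = k + 1 by omega, Nat.sub_add_cancel hKk] at this
  exact hk _ this

end Model

/-! ### The noise matrix -/

section Noise

variable {n p : ℕ} {A : Fin n → Matrix (Fin p) (Fin p) ℝ} {lam Lam : ℝ}

/-- The matrix `(1/n) ∑ᵢ eᵢ Aᵢ`. -/
noncomputable def noiseMatrix (A : Fin n → Matrix (Fin p) (Fin p) ℝ) (e : Fin n → ℝ) :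
    Matrix (Fin p) (Fin p) ℝ :=
  (1 / (n : ℝ)) • ∑ i, e i • A i

lemma noiseMatrix_apply (e : Fin n → ℝ) (j k : Fin p) :
    noiseMatrix A e j k = (1 / (n : ℝ)) * ∑ i, A i j k * e i := by
  simp [noiseMatrix, Matrix.sum_apply, mul_comm]

lemma norm_act_sq_le (M : Matrix (Fin p) (Fin p) ℝ) (v : Vec p) :
    ‖act M v‖ ^ 2 ≤ (∑ j, ∑ k, M j k ^ 2) * ‖v‖ ^ 2 := by
  rw [EuclideanSpace.real_norm_sq_eq, EuclideanSpace.real_norm_sq_eq, Finset.sum_mul]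
  refine Finset.sum_le_sum fun j _ => ?_
  simp only [act, Matrix.ofLp_toEuclideanCLM, Matrix.mulVec, dotProduct]
  exact Finset.sum_mul_sq_le_sq_mul_sq _ _ _

/-- The Frobenius norm of the noise matrix bounds the noise form. -/
lemma abs_inner_noise_le {e : Fin n → ℝ} {τ : ℝ} (hτ : 0 ≤ τ)
    (he : ∑ j, ∑ k, noiseMatrix A e j k ^ 2 ≤ τ ^ 2) (u v : Vec p) :
    |⟪normalize e, designForm A u v⟫| ≤ τ * ‖u‖ * ‖v‖ := by
  have h1 : ⟪normalize e, designForm A u v⟫ = ⟪u, act (noiseMatrix A e) v⟫ := by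
    have : act (noiseMatrix A e) v = (1 / (n : ℝ)) • ∑ i, e i • act (A i) v := by
      rw [← act_sum_smul]; simp [noiseMatrix, act]
    rw [designForm_apply, inner_normalize, this, inner_smul_right, inner_sum]
    simp [inner_smul_right]
  have h2 : ‖act (noiseMatrix A e) v‖ ≤ τ * ‖v‖ := by
    refine le_of_sq_le_sq ?_ (by positivity)
    rw [mul_pow]
    exact (norm_act_sq_le _ v).trans (by gcongr)
  rw [h1]
  calc _ ≤ ‖u‖ * ‖act (noiseMatrix A e) v‖ := abs_real_inner_le_norm _ _
    _ ≤ ‖u‖ * (τ * ‖v‖) := by gcongr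
    _ = _ := by ring

/-- Testing the isometry condition on unit vectors bounds the second moments of the entries. -/
lemma sum_entry_sq_le (hA : IsometryBounds A lam Lam) (j k : Fin p) :
    (1 / (n : ℝ)) * ∑ i, A i j k ^ 2 ≤ Lam := by
  have h := (hA (EuclideanSpace.single j 1) (EuclideanSpace.single k 1)).2
  simpa [act, Matrix.inner_toEuclideanCLM] using h

variable {Ω : Type*} [MeasurableSpace Ω] {P : Measure Ω} [IsProbabilityMeasure P]

lemma sq_le_exp_add_exp (x : ℝ) : x ^ 2 ≤ 2 * (Real.exp x + Real.exp (-x)) := by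
  rcases le_total 0 x with h | h
  · nlinarith [Real.quadratic_le_exp_of_nonneg h, Real.exp_pos (-x)]
  · nlinarith [Real.quadratic_le_exp_of_nonneg (neg_nonneg.2 h), Real.exp_pos x]

lemma variance_le_of_subgaussian {X : Ω → ℝ} {s : ℝ≥0} (hX : HasSubgaussianMGF X s P) :
    variance X P ≤ 4 * Real.exp (s / 2) := by
  have i1 : Integrable (fun ω => Real.exp (X ω)) P := by
    simpa using hX.integrable_exp_mul 1
  have i2 : Integrable (fun ω => Real.exp (-X ω)) P := by
    simpa using hX.integrable_exp_mul (-1)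
  have m1 : ∫ ω, Real.exp (X ω) ∂P ≤ Real.exp (s / 2) := by
    simpa [mgf] using hX.mgf_le 1
  have m2 : ∫ ω, Real.exp (-X ω) ∂P ≤ Real.exp (s / 2) := by
    simpa [mgf] using hX.mgf_le (-1)
  calc variance X P ≤ ∫ ω, (X ^ 2) ω ∂P := variance_le_expectation_sq hX.aestronglyMeasurable
    _ ≤ ∫ ω, 2 * (Real.exp (X ω) + Real.exp (-X ω)) ∂P := by
        refine integral_mono ?_ ((i1.add i2).const_mul 2) fun ω => sq_le_exp_add_exp (X ω)
        exact (hX.memLp 2).integrable_sq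
    _ ≤ _ := by
        rw [integral_const_mul, integral_add i1 i2]
        linarith

/-- The expected square of an entry of the noise matrix is of order `1/n`. -/
lemma integral_noiseMatrix_sq_le {ε : Fin n → Ω → ℝ} {ς : ℝ≥0}
    (hε : IsSubgaussianNoise P ε ς) (hA : IsometryBounds A lam Lam) (j k : Fin p) :
    Integrable (fun ω => noiseMatrix A (fun i => ε i ω) j k ^ 2) P ∧
      ∫ ω, noiseMatrix A (fun i => ε i ω) j k ^ 2 ∂P ≤
        4 * Real.exp ((ς ^ 2 : ℝ≥0) / 2) * Lam / n := by
  set V := 4 * Real.exp ((ς ^ 2 : ℝ≥0) / 2) with hV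
  set Y : Fin n → Ω → ℝ := fun i ω => A i j k * ε i ω with hY
  have hmem : ∀ i, MemLp (Y i) 2 P := fun i => ((hε.subgaussian i).memLp 2).const_mul _
  have hsum : MemLp (∑ i, Y i) 2 P := memLp_finsetSum' _ fun i _ => hmem i
  have heq : ∀ ω, noiseMatrix A (fun i => ε i ω) j k = (1 / (n : ℝ)) * (∑ i, Y i) ω := by
    intro ω
    simp [noiseMatrix_apply, hY]
  have hvar : ∫ ω, (∑ i, Y i) ω ^ 2 ∂P = ∑ i, A i j k ^ 2 * variance (ε i) P := by
    rw [← variance_of_integral_eq_zero hsum.aemeasurable, IndepFun.variance_sum]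
    · exact Finset.sum_congr rfl fun i _ => variance_const_mul _ _ _
    · exact fun i _ => hmem i
    · intro i _ i' _ hne
      exact (hε.indep.indepFun hne).comp (measurable_const_mul (A i j k))
        (measurable_const_mul (A i' j k))
    · simp only [Finset.sum_apply]
      rw [integral_finsetSum _ fun i _ => (hmem i).integrable one_le_two]
      exact Finset.sum_eq_zero fun i _ => by
        simp [hY, integral_const_mul, hε.mean_zero]
  simp only [heq, mul_pow]
  refine ⟨hsum.integrable_sq.const_mul _, ?_⟩
  rw [integral_const_mul, hvar]
  have h1 : ∑ i, A i j k ^ 2 * variance (ε i) P ≤ V * ∑ i, A i j k ^ 2 := by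
    rw [Finset.mul_sum]
    refine Finset.sum_le_sum fun i _ => ?_
    rw [mul_comm]
    gcongr
    exact variance_le_of_subgaussian (hε.subgaussian i)
  calc (1 / (n : ℝ)) ^ 2 * ∑ i, A i j k ^ 2 * variance (ε i) P
      ≤ (1 / (n : ℝ)) ^ 2 * (V * ∑ i, A i j k ^ 2) := by gcongr
    _ = V * (1 / (n : ℝ)) * ((1 / (n : ℝ)) * ∑ i, A i j k ^ 2) := by ring
    _ ≤ V * (1 / (n : ℝ)) * Lam := by gcongr; exact sum_entry_sq_le hA j k
    _ = _ := by ring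

/-- Markov's inequality for the squared Frobenius norm of the noise matrix. -/
lemma measure_noiseMatrix_le {ε : Fin n → Ω → ℝ} {ς : ℝ≥0}
    (hε : IsSubgaussianNoise P ε ς) (hA : IsometryBounds A lam Lam) {τ : ℝ} (hτ : 0 < τ) :
    P {ω | τ ^ 2 ≤ ∑ j, ∑ k, noiseMatrix A (fun i => ε i ω) j k ^ 2} ≤
      ENNReal.ofReal (4 * Real.exp ((ς ^ 2 : ℝ≥0) / 2) * Lam / τ ^ 2 * ((p : ℝ) ^ 2 / n)) := by
  have hi := fun j k => integral_noiseMatrix_sq_le hε hA j k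
  have hint : ∀ j, Integrable (fun ω => ∑ k, noiseMatrix A (fun i => ε i ω) j k ^ 2) P :=
    fun j => integrable_finsetSum _ fun k _ => (hi j k).1
  have hM := mul_meas_ge_le_integral_of_nonneg
    (ae_of_all P fun ω => show (0 : ℝ) ≤ ∑ j, ∑ k, noiseMatrix A (fun i => ε i ω) j k ^ 2 by
      positivity)
    (integrable_finsetSum _ fun j _ => hint j) (τ ^ 2)
  rw [integral_finsetSum _ fun j _ => hint j] at hM
  simp only [integral_finsetSum _ fun k _ => (hi _ k).1] at hM
  have hsum : ∑ j : Fin p, ∑ k : Fin p, ∫ ω, noiseMatrix A (fun i => ε i ω) j k ^ 2 ∂P ≤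
      (p : ℝ) ^ 2 * (4 * Real.exp ((ς ^ 2 : ℝ≥0) / 2) * Lam / n) := by
    calc _ ≤ ∑ _j : Fin p, ∑ _k : Fin p, 4 * Real.exp ((ς ^ 2 : ℝ≥0) / 2) * Lam / n :=
          Finset.sum_le_sum fun j _ => Finset.sum_le_sum fun k _ => (hi j k).2
      _ = _ := by simp; ring
  rw [← ofReal_measureReal]
  refine ENNReal.ofReal_le_ofReal ?_
  have hτ2 : 0 < τ ^ 2 := by positivity
  rw [div_mul_eq_mul_div, le_div_iff₀ hτ2]
  calc _ ≤ _ := by rw [mul_comm]; exact hM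
    _ ≤ _ := hsum
    _ = _ := by ring

end Noise

/-- The dimension condition in the form needed for the Frobenius norm: `p² = o(n)`. -/
lemma tendsto_sq_div {p : ℕ → ℕ}
    (hp : Tendsto (fun n : ℕ => (p n : ℝ) ^ 3 * Real.log (1 + 2 * (n : ℝ)) / (n : ℝ))
      atTop (𝓝 0)) : Tendsto (fun n : ℕ => (p n : ℝ) ^ 2 / n) atTop (𝓝 0) := by
  refine squeeze_zero' (Eventually.of_forall fun n => by positivity) ?_ hp
  filter_upwards [eventually_ge_atTop 1] with n hn
  have hn' : (1 : ℝ) ≤ n := by exact_mod_cast hn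
  have hlog : 1 ≤ Real.log (1 + 2 * (n : ℝ)) := by
    rw [Real.le_log_iff_exp_le (by positivity)]
    linarith [Real.exp_one_lt_three]
  have hpow : (p n : ℝ) ^ 2 ≤ (p n : ℝ) ^ 3 := by
    exact_mod_cast (Nat.eq_zero_or_pos (p n)).elim (fun h => by simp [h])
      fun h => Nat.pow_le_pow_right h (by norm_num)
  gcongr
  nlinarith [pow_nonneg (Nat.cast_nonneg (α := ℝ) (p n)) 3]

end QMR

theorem mainTheorem9
    -- constants that do not depend on `n`
    (lam Lam : ℝ) (hlam : 0 < lam) (hLam : 0 < Lam) (hlt : Lam < 3 * lam)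
    (ς : ℝ≥0) (hς : 0 < ς) (r : ℝ) (hr : 0 < r)
    (c : QMR.Params) (hμ₂ : c.μ₂ ∈ Set.Ioo (0 : ℝ) (1 / 2))
    -- for each `n`: dimension, symmetric measurement matrices, signal, noise, initial point
    (p : ℕ → ℕ)
    (A : ∀ n : ℕ, Fin n → Matrix (Fin (p n)) (Fin (p n)) ℝ)
    (hsymm : ∀ n i, (A n i).IsSymm)
    (hA : ∀ᶠ n in atTop, QMR.IsometryBounds (A n) lam Lam)
    (xstar : ∀ n : ℕ, QMR.Vec (p n))
    (hxstar : ∀ᶠ n in atTop, r ≤ ‖xstar n‖)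
    (Ω : ℕ → Type*) [∀ n, MeasurableSpace (Ω n)]
    (P : ∀ n : ℕ, Measure (Ω n)) [∀ n, IsProbabilityMeasure (P n)]
    (ε : ∀ n : ℕ, Fin n → Ω n → ℝ)
    (hε : ∀ n, QMR.IsSubgaussianNoise (P n) (ε n) ς)
    (x₀ : ∀ n : ℕ, Ω n → QMR.Vec (p n))
    (hp : Tendsto (fun n : ℕ => (p n : ℝ) ^ 3 * Real.log (1 + 2 * (n : ℝ)) / (n : ℝ))
      atTop (𝓝 0)) :
    -- the whole sequence converges to `xbar`
    (∀ᶠ n in atTop, ∀ (ω : Ω n) (xbar : QMR.Vec (p n)),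
      QMR.IsGoodAccPt (A n) (QMR.observe (A n) (xstar n) fun i => ε n i ω) c (x₀ n ω) lam xbar →
      Tendsto (QMR.grnm (A n) (QMR.observe (A n) (xstar n) fun i => ε n i ω) c (x₀ n ω))
        atTop (𝓝 xbar)) ∧
    -- and its rate at `xbar` tends to zero in probability
    (∀ η : ℝ≥0∞, 0 < η →
      Tendsto (fun n : ℕ => P n {ω | ∃ xbar : QMR.Vec (p n),
        QMR.IsGoodAccPt (A n) (QMR.observe (A n) (xstar n) fun i => ε n i ω) c (x₀ n ω) lam xbar ∧
        η ≤ QMR.rate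
          (QMR.grnm (A n) (QMR.observe (A n) (xstar n) fun i => ε n i ω) c (x₀ n ω)) xbar})
        atTop (𝓝 0)) := by
  refine ⟨?_, fun η hη => ?_⟩
  · filter_upwards [hA] with n hAn ω xbar hgood
    exact QMR.tendsto_grnm hlam hLam (hsymm n) hAn hgood
  obtain ⟨η', hη'0, hη'η⟩ := exists_between hη
  have hη'top : η' ≠ ⊤ := hη'η.ne_top
  -- a real target rate below `η`, small enough for full Newton steps to be accepted
  set η₀ := min η'.toReal (1 - 2 * c.μ₂) with hη₀
  have hη₀pos : 0 < η₀ :=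
    lt_min (ENNReal.toReal_pos hη'0.ne' hη'top) (by linarith [hμ₂.2])
  have hη₀lt : ENNReal.ofReal η₀ < η :=
    (ENNReal.ofReal_le_of_le_toReal (min_le_left _ _)).trans_lt hη'η
  -- the noise level below which the rate is at most `η₀`
  set τ := min (lam * r ^ 2 / 4) (η₀ * (lam ^ 2 * r ^ 2) / (2 * (2 * Lam + lam))) with hτ
  have hτ0 : 0 < τ := by positivity
  have hτ1 : 4 * τ ≤ lam * r ^ 2 := by
    have := min_le_left (lam * r ^ 2 / 4) (η₀ * (lam ^ 2 * r ^ 2) / (2 * (2 * Lam + lam)))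
    linarith
  have hτ2 : (2 * Lam + lam) * τ < η₀ * (lam ^ 2 * r ^ 2) := by
    have h1 : τ ≤ η₀ * (lam ^ 2 * r ^ 2) / (2 * (2 * Lam + lam)) := min_le_right _ _
    rw [le_div_iff₀ (by positivity)] at h1
    have h2 : 0 < (2 * Lam + lam) * τ := by positivity
    linarith
  have hlim := (ENNReal.tendsto_ofReal ((QMR.tendsto_sq_div hp).const_mul
    (4 * Real.exp ((ς ^ 2 : ℝ≥0) / 2) * Lam / τ ^ 2)))
  rw [mul_zero, ENNReal.ofReal_zero] at hlim
  refine tendsto_of_tendsto_of_tendsto_of_le_of_le' tendsto_const_nhds hlim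
    (Eventually.of_forall fun _ => zero_le) ?_
  filter_upwards [hA, hxstar] with n hAn hxn
  refine (measure_mono ?_).trans (QMR.measure_noiseMatrix_le (hε n) hAn hτ0)
  rintro ω ⟨xbar, hgood, hrate⟩
  rw [Set.mem_ofPred_eq]
  by_contra hlt
  have hform := QMR.abs_inner_noise_le hτ0.le (not_le.1 hlt).le
  have := QMR.rate_grnm_le hlam hLam (hsymm n) hAn hxn hr hμ₂ hη₀pos (min_le_right _ _) hform
    hτ1 hτ2 hgood
  exact absurd (hrate.trans this) (not_le.2 hη₀lt)
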